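/- All graphs are finite, simple and undirected. The Weisfeiler–Leman dimension (WL-dimension) of a graph $\Gamma$ is the smallest positive integer $d$ such that the $d$-dimensional Weisfeiler–Leman algorithm distinguishes $\Gamma$ from every graph not isomorphic to it. Here the $1$-dimensional algorithm is colour refinement; for $d\ge 2$ the $d$-dimensional algorithm colours the $d$-tuples of vertices, first by their equality and adjacency types, and in each round refines the colour of $(v_1,\dots,v_d)$ by the multiset, over all vertices $w$, of the $d$-tuples of colours of the tuples obtained by replacing one entry $v_j$, $j=1,\dots,d$, by $w$. Two graphs are distinguished if after some number of rounds their multisets of colours differ. $K_n$ is the complete graph on $n$ vertices, $\Gamma_1\times\Gamma_2$ is the Cartesian product and $\Gamma_1[\Gamma_2]$ is the lexicographic product, in which $(v_1,v_2)$ and $(u_1,u_2)$ are adjacent iff $v_1u_1$ is an edge of $\Gamma_1$, or $v_1=u_1$ and $v_2u_2$ is an edge of $\Gamma_2$. For a group $G$ and an inverse-closed $S\subseteq G\setminus\{e\}$, $\mathrm{Cay}(G,S)$ is the graph on $G$ with edges $\{g,sg\}$, $g\in G$, $s\in S$. A cyclic difference set with $v(D)=n$ is a subset $D$ of a cyclic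 group $A$ of order $n$ such that, for some positive integer $\lambda$, every non-identity element of $A$ equals $a^{-1}b$ for exactly $\lambda$ pairs $(a,b)\in D\times D$; it is nontrivial if $|D|<n-1$. Given such a $D$, let $G$ be a dihedral group of order $2n$ with $A$ as its rotation subgroup, let $x\in G\setminus A$, and put $\Gamma(D)=\mathrm{Cay}(G,(A\setminus\{e\})\cup xD)$. For odd $k\ge 3$ let $G=\langle x,y : x^{4k}=y^2=e,\ y^{-1}xy=x^{-1}\rangle$ be the dihedral group of order $8k$, $A_1=\langle x^4\rangle$, and $\Sigma(k)=\mathrm{Cay}(G,Z)$ with $$Z=x^2A_1\cup y\bigl(A_1\setminus\{x^{2(k-1)}\}\bigr)\cup\{yx^{2k-1},\,yx^{-2},\,yx^{-1}\}.$$ Theorem. Each of the following graphs has WL-dimension exactly $2$: (1) $K_m[\Gamma(D)]$, where $m\ge 1$ and $D$ is a nontrivial cyclic difference set with $v(D)\le 13$; (2) $K_m[K_4\times K_2]$, where $m\ge 1$; (3) $\Sigma(k)$, where $k\ge 3$ is odd. -/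

import Mathlib

/-! ### The Weisfeiler-Leman algorithm -/

/-- The colours used by the 1-dimensional Weisfeiler-Leman algorithm (colour refinement)
after `i` rounds. -/
def WLVertexColor : ℕ → Type
  | 0 => Unit
  | i + 1 => WLVertexColor i × Multiset (WLVertexColor i)

open Classical in
/-- Colour refinement: all vertices start with the same colour, and in every round the colour of a
vertex is refined by the multiset of the colours of its neighbours. -/
noncomputable def wlVertexColor {V : Type*} [Fintype V] (G : SimpleGraph V) :
    (i : ℕ) → V → WLVertexColor i
  | 0, _ => ()
  | i + 1, v =>
    (wlVertexColor G i v,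
      (Finset.univ.filter (fun w => G.Adj v w)).val.map (fun w => wlVertexColor G i w))

/-- The colours used by the `d`-dimensional Weisfeiler-Leman algorithm, `d ≥ 2`,
after `i` rounds. -/
def WLTupleColor (d : ℕ) : ℕ → Type
  | 0 => Fin d → Fin d → Prop × Prop
  | i + 1 => WLTupleColor d i × Multiset (Fin d → WLTupleColor d i)

/-- The `d`-dimensional Weisfeiler-Leman algorithm, `d ≥ 2`: the initial colour of a `d`-tuple of
vertices is its atomic type (which entries are equal and which are adjacent), and in every round
the colour of `v` is refined by the multiset, over all vertices `w`, of the `d`-tuples of colours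
of `v[w/1], …, v[w/d]`, where `v[w/j]` is `v` with its `j`-th entry replaced by `w`. -/
noncomputable def wlTupleColor {V : Type*} [Fintype V] (G : SimpleGraph V) (d : ℕ) :
    (i : ℕ) → (Fin d → V) → WLTupleColor d i
  | 0, v => fun a b => (v a = v b, G.Adj (v a) (v b))
  | i + 1, v =>
    (wlTupleColor G d i v,
      (Finset.univ : Finset V).val.map
        (fun w => fun j : Fin d => wlTupleColor G d i (Function.update v j w)))

/-- The `d`-dimensional Weisfeiler-Leman algorithm distinguishes `G` and `H` (`d ≥ 1`): after some
number of rounds the multisets of the colours occurring in `G` and in `H` are different. -/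
def WLDistinguishes {V W : Type*} [Fintype V] [Fintype W] (d : ℕ)
    (G : SimpleGraph V) (H : SimpleGraph W) : Prop :=
  if d = 1 then
    ∃ i : ℕ, (Finset.univ : Finset V).val.map (wlVertexColor G i) ≠
      (Finset.univ : Finset W).val.map (wlVertexColor H i)
  else
    ∃ i : ℕ, (Finset.univ : Finset (Fin d → V)).val.map (wlTupleColor G d i) ≠
      (Finset.univ : Finset (Fin d → W)).val.map (wlTupleColor H d i)

/-- The `d`-dimensional Weisfeiler-Leman algorithm identifies `G` (`d ≥ 1`): it distinguishes `G`
from every finite graph that is not isomorphic to `G`. -/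
def WLIdentifies {V : Type*} [Fintype V] (d : ℕ) (G : SimpleGraph V) : Prop :=
  ∀ (W : Type) [Fintype W] (H : SimpleGraph W), ¬ Nonempty (G ≃g H) → WLDistinguishes d G H

/-- The Weisfeiler-Leman dimension of a finite graph: the smallest positive integer `d` such that
the `d`-dimensional Weisfeiler-Leman algorithm identifies the graph. -/
noncomputable def wlDim {V : Type*} [Fintype V] (G : SimpleGraph V) : ℕ :=
  sInf {d : ℕ | 1 ≤ d ∧ WLIdentifies d G}

/-! ### Graphs -/

/-- The lexicographic product `G[H]`. -/
def lexProductGraph {V W : Type*} (G : SimpleGraph V) (H : SimpleGraph W) :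
    SimpleGraph (V × W) where
  Adj p q := G.Adj p.1 q.1 ∨ (p.1 = q.1 ∧ H.Adj p.2 q.2)
  symm := ⟨by
    rintro p q (h | ⟨h, h'⟩)
    · exact Or.inl h.symm
    · exact Or.inr ⟨h.symm, h'.symm⟩⟩
  loopless := ⟨by
    rintro p (h | ⟨_, h⟩)
    · exact G.irrefl h
    · exact H.irrefl h⟩

/-- The Cayley graph `Cay(G, S)` of a group `G` with respect to an identity-free inverse-closed
set `S`: the edges are the pairs `(g, s g)` with `g ∈ G` and `s ∈ S`. -/
def cayleyGraph {G : Type*} [Group G] (S : Set G) (hone : (1 : G) ∉ S)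
    (hinv : ∀ s ∈ S, s⁻¹ ∈ S) : SimpleGraph G where
  Adj g h := h * g⁻¹ ∈ S
  symm := ⟨by
    intro g h hs
    have := hinv _ hs
    simpa using this⟩
  loopless := ⟨by
    intro g hs
    apply hone
    simpa using hs⟩

/-- `D` is a difference set in the finite (additive) group `A`: for some positive `lam`, every
nonzero element of `A` has exactly `lam` representations `-a + b` with `a, b ∈ D`. -/
def IsDifferenceSet {A : Type*} [AddGroup A] [DecidableEq A] (D : Finset A) : Prop :=
  ∃ lam : ℕ, 0 < lam ∧
    ∀ g : A, g ≠ 0 → ((D ×ˢ D).filter (fun p => -p.1 + p.2 = g)).card = lam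

/-- The connection set `A^# ∪ x D` in the dihedral group of order `2 n`, where `A` is the subgroup
of the rotations `r i` (identified with `ZMod n`) and `x = sr j` is an arbitrary element
outside `A`. -/
def gammaSet (n : ℕ) (D : Finset (ZMod n)) (j : ZMod n) : Set (DihedralGroup n) :=
  {g | ∃ i : ZMod n, i ≠ 0 ∧ g = DihedralGroup.r i} ∪
    {g | ∃ d ∈ D, g = DihedralGroup.sr j * DihedralGroup.r d}

theorem gammaSet_one (n : ℕ) (D : Finset (ZMod n)) (j : ZMod n) :
    (1 : DihedralGroup n) ∉ gammaSet n D j := by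
  rintro (⟨i, hi, h⟩ | ⟨d, _, h⟩)
  · rw [DihedralGroup.one_def] at h
    exact hi (DihedralGroup.r.inj h).symm
  · rw [DihedralGroup.one_def, DihedralGroup.sr_mul_r] at h
    cases h

theorem gammaSet_inv (n : ℕ) (D : Finset (ZMod n)) (j : ZMod n) :
    ∀ s ∈ gammaSet n D j, s⁻¹ ∈ gammaSet n D j := by
  rintro s (⟨i, hi, rfl⟩ | ⟨d, hd, rfl⟩)
  · exact Or.inl ⟨-i, neg_ne_zero.mpr hi, rfl⟩
  · exact Or.inr ⟨d, hd, rfl⟩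

/-- The graph `Γ(D) = Cay(G, A^# ∪ x D)`, where `G` is the dihedral group of order `2 n` and
`x = sr j`. -/
def gammaGraph (n : ℕ) (D : Finset (ZMod n)) (j : ZMod n) : SimpleGraph (DihedralGroup n) :=
  cayleyGraph (gammaSet n D j) (gammaSet_one n D j) (gammaSet_inv n D j)

/-- The standard generator of order `4 k` of the dihedral group of order `8 k`. -/
def dihX (k : ℕ) : DihedralGroup (4 * k) := DihedralGroup.r 1

/-- The standard reflection of the dihedral group of order `8 k`. -/
def dihY (k : ℕ) : DihedralGroup (4 * k) := DihedralGroup.sr 0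

/-- The connection set
`x² A₁ ∪ y (A₁ \ {x^(2(k-1))}) ∪ {y x^(2k-1), y x^(-2), y x^(-1)}` with `A₁ = ⟨x⁴⟩`. -/
def sigmaSet (k : ℕ) : Set (DihedralGroup (4 * k)) :=
  {g | ∃ a ∈ Subgroup.zpowers (dihX k ^ 4), g = dihX k ^ 2 * a} ∪
  {g | ∃ a ∈ Subgroup.zpowers (dihX k ^ 4),
    a ≠ dihX k ^ (2 * ((k : ℤ) - 1)) ∧ g = dihY k * a} ∪
  {dihY k * dihX k ^ (2 * (k : ℤ) - 1), dihY k * dihX k ^ (-2 : ℤ), dihY k * dihX k ^ (-1 : ℤ)}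

theorem sigmaSet_one (k : ℕ) : (1 : DihedralGroup (4 * k)) ∉ sigmaSet k := by
  have key : ∀ z : ℤ, (1 : DihedralGroup (4 * k)) ≠ dihY k * dihX k ^ z := by
    intro z h
    rw [dihX, dihY, DihedralGroup.r_zpow, DihedralGroup.one_def, DihedralGroup.sr_mul_r] at h
    cases h
  have pow4 : ∀ z : ℤ, (dihX k ^ 4) ^ z = dihX k ^ (4 * z) := by
    intro z
    rw [zpow_mul]
    norm_cast
  rintro ((⟨a, ⟨z, rfl⟩, h⟩ | ⟨a, ⟨z, rfl⟩, _, h⟩) | h)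
  · simp only [pow4] at h
    rw [← zpow_natCast, ← zpow_add, dihX, DihedralGroup.r_zpow, DihedralGroup.one_def] at h
    have h1 := (DihedralGroup.r.inj h).symm
    rw [one_mul, ZMod.intCast_zmod_eq_zero_iff_dvd] at h1
    obtain ⟨c, hc⟩ := h1
    push_cast at hc
    have h4 : (4 : ℤ) ∣ 2 := ⟨k * c - z, by linarith⟩
    norm_num at h4
  · simp only [pow4] at h
    exact key _ h
  · simp only [Set.mem_insert_iff, Set.mem_singleton_iff] at h
    rcases h with h | h | h <;> exact key _ h

theorem sigmaSet_inv (k : ℕ) : ∀ s ∈ sigmaSet k, s⁻¹ ∈ sigmaSet k := by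
  have key : ∀ z : ℤ, (dihY k * dihX k ^ z)⁻¹ = dihY k * dihX k ^ z := by
    intro z
    rw [dihX, dihY, DihedralGroup.r_zpow, DihedralGroup.sr_mul_r, DihedralGroup.inv_sr]
  have pow4 : ∀ z : ℤ, (dihX k ^ 4) ^ z = dihX k ^ (4 * z) := by
    intro z
    rw [zpow_mul]
    norm_cast
  rintro s ((⟨a, ⟨z, rfl⟩, rfl⟩ | ⟨a, ⟨z, rfl⟩, hne, rfl⟩) | h)
  · refine Or.inl (Or.inl ⟨(dihX k ^ 4) ^ (-1 - z), ⟨_, rfl⟩, ?_⟩)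
    simp only [pow4]
    rw [← zpow_natCast, ← zpow_add, ← zpow_add, ← zpow_neg]
    congr 1
    push_cast
    ring
  · refine Or.inl (Or.inr ⟨_, ⟨z, rfl⟩, hne, ?_⟩)
    simp only [pow4]
    exact key _
  · refine Or.inr ?_
    simp only [Set.mem_insert_iff, Set.mem_singleton_iff] at h ⊢
    rcases h with rfl | rfl | rfl <;> simp only [key, true_or, or_true]

/-- The graph `Σ(k)`, a Cayley graph over the dihedral group of order `8 k`. -/
def sigmaGraph (k : ℕ) : SimpleGraph (DihedralGroup (4 * k)) :=
  cayleyGraph (sigmaSet k) (sigmaSet_one k) (sigmaSet_inv k)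

/-!
The theorem rests on a transfer principle. If the two-dimensional algorithm does not distinguish two
graphs, then the pairs of vertices of equal stable colour form a bisimulation (`PairBisim`): whenever
two pairs correspond, the third vertices can be matched bijectively so that the new pairs correspond
again. Hence binary relations that are built from equality and adjacency by Boolean operations and
by counting over a third vertex correspond in the two graphs (`PairBisim.Inv`), and universal
statements on three vertices about such relations carry over (`PairBisim.Inv.transfer₃`). So a graph
that is determined up to isomorphism by its order and statements of this kind has dimension at most
two. It has dimension exactly two if in addition it is regular and some nonisomorphic regular graph
has the same order and degree, because colour refinement does not separate the two (`wlDim_eq_two`).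

For the first two families, the complement of `K_m[Y]` consists of `m` disjoint copies of the
complement of `Y`, and the latter is the incidence graph of a symmetric design: the development of
the complement of the difference set `D`, or the `2-(4, 3, 2)` design. Disjoint unions of incidence
graphs of symmetric designs with given parameters are characterised by three-variable axioms
(`IsIncidenceUnion`), since the points and the blocks of a component are the classes of the relation
"equal or with a common neighbour". So what remains is that the design is determined by its
parameters. Counting differences leaves, up to complements, the Fano plane, the biplane with 11
points and the plane of order three; each is reconstructed by coordinates
(`uniqueSymDesign_seven`, `uniqueSymDesign_eleven`, `uniqueSymDesign_thirteen`). The same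
construction from a set that is not a difference set gives the graphs for the lower bound.

For the third family, `Σ(k)` is a twisted cycle (`sigmaGraph_adj_iff`): take the cycle of length
`4 k`, replace each vertex by two twins, divide the resulting `8 k` vertices into four classes of
`2 k` vertices, which form two opposite pairs, and exchange edges and non-edges between opposite
classes. The number of common neighbours of two vertices tells whether they are in the same class
(`IsTwistedCycle.commonCount_eq`), and the number of neighbours in a class tells which class is
opposite. This recovers the cycle with doubled vertices, and by recursion the distances along it. In
a graph with the same stable colours, a walk along the recovered cycle gives coordinates that
determine the graph (`IsTwistedSystem.exists_coordinates`).
-/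

/-! ### Transfer of definable relations along the 2-dimensional Weisfeiler-Leman algorithm -/

theorem exists_equiv_of_map_univ_eq {V W C : Type*} [Fintype V] [Fintype W]
    (f : V → C) (g : W → C)
    (h : (Finset.univ : Finset V).val.map f = (Finset.univ : Finset W).val.map g) :
    ∃ e : V ≃ W, ∀ v, g (e v) = f v := by
  classical
  have hc : ∀ c : C, Nonempty ({v // f v = c} ≃ {w // g w = c}) := by
    intro c
    rw [← Fintype.card_eq]
    have := congrArg (Multiset.count c) h
    rw [Multiset.count_map, Multiset.count_map] at this
    rw [Fintype.card_subtype, Fintype.card_subtype]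
    simpa [eq_comm, Finset.card_def] using this
  exact ⟨Equiv.ofFiberEquiv fun c => (hc c).some,
    fun v => Equiv.ofFiberEquiv_map (fun c => (hc c).some) v⟩

/-- A bisimulation between the ordered pairs of vertices of `G` and those of `H`: a relation that
respects atomic types, relates every pair to some pair, and satisfies the step condition of the
2-dimensional Weisfeiler-Leman algorithm (the bijective pebble game on three pebbles). -/
structure PairBisim {V W : Type*} (G : SimpleGraph V) (H : SimpleGraph W) where
  /-- `rel u v u' v'`: the pair `(u, v)` is related to the pair `(u', v')`. -/
  rel : V → V → W → W → Prop
  eq_iff : ∀ {u v u' v'}, rel u v u' v' → (u = v ↔ u' = v')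
  adj_iff : ∀ {u v u' v'}, rel u v u' v' → (G.Adj u v ↔ H.Adj u' v')
  step : ∀ {u v u' v'}, rel u v u' v' →
    ∃ f : V ≃ W, ∀ w, rel w v (f w) v' ∧ rel u w u' (f w)
  left_total : ∀ u v, ∃ u' v', rel u v u' v'
  right_total : ∀ u' v', ∃ u v, rel u v u' v'

theorem wlTupleColor_eq_of_le {V W : Type*} [Fintype V] [Fintype W] {G : SimpleGraph V}
    {H : SimpleGraph W} {d i j : ℕ} (hij : i ≤ j) {v : Fin d → V} {w : Fin d → W}
    (h : wlTupleColor G d j v = wlTupleColor H d j w) :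
    wlTupleColor G d i v = wlTupleColor H d i w := by
  induction hij with
  | refl => exact h
  | step _ ih => exact ih (congrArg Prod.fst h)

/-- If for every round there is a bijection with a property that survives in all earlier rounds,
then one bijection works for all rounds. -/
theorem exists_equiv_forall_nat {V W : Type*} [Finite V] [Finite W] (p : ℕ → (V ≃ W) → Prop)
    (hmono : ∀ i j f, i ≤ j → p j f → p i f) (h : ∀ i, ∃ f, p i f) : ∃ f, ∀ i, p i f := by
  choose f hf using h
  obtain ⟨e, he⟩ := Finite.exists_infinite_fiber f
  refine ⟨e, fun i => ?_⟩
  obtain ⟨j, hj, hij⟩ := (Set.infinite_coe_iff.1 he).exists_gt i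
  have : f j = e := hj
  exact hmono i j e hij.le (this ▸ hf j)

theorem nonempty_pairBisim {V W : Type*} [Fintype V] [Fintype W] {G : SimpleGraph V}
    {H : SimpleGraph W} (h : ¬ WLDistinguishes 2 G H) : Nonempty (PairBisim G H) := by
  have h2 : ∀ i, (Finset.univ : Finset (Fin 2 → V)).val.map (wlTupleColor G 2 i) =
      (Finset.univ : Finset (Fin 2 → W)).val.map (wlTupleColor H 2 i) := by
    simpa [WLDistinguishes] using h
  have hu0 : ∀ u v w : V, Function.update ![u, v] (0 : Fin 2) w = ![w, v] := by
    intro u v w; ext i; fin_cases i <;> rfl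
  have hu1 : ∀ u v w : V, Function.update ![u, v] (1 : Fin 2) w = ![u, w] := by
    intro u v w; ext i; fin_cases i <;> rfl
  have hu0' : ∀ u v w : W, Function.update ![u, v] (0 : Fin 2) w = ![w, v] := by
    intro u v w; ext i; fin_cases i <;> rfl
  have hu1' : ∀ u v w : W, Function.update ![u, v] (1 : Fin 2) w = ![u, w] := by
    intro u v w; ext i; fin_cases i <;> rfl
  obtain ⟨F, hF⟩ := exists_equiv_forall_nat
    (fun i (F : (Fin 2 → V) ≃ (Fin 2 → W)) => ∀ v, wlTupleColor H 2 i (F v) = wlTupleColor G 2 i v)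
    (fun i j F hij hF v => (wlTupleColor_eq_of_le hij (hF v).symm).symm)
    (fun i => exists_equiv_of_map_univ_eq _ _ (h2 i))
  have heta : ∀ v : Fin 2 → V, v = ![v 0, v 1] := by
    intro v; ext i; fin_cases i <;> rfl
  have heta' : ∀ v : Fin 2 → W, v = ![v 0, v 1] := by
    intro v; ext i; fin_cases i <;> rfl
  refine ⟨⟨fun u v u' v' => ∀ i, wlTupleColor G 2 i ![u, v] = wlTupleColor H 2 i ![u', v'],
    ?_, ?_, ?_, ?_, ?_⟩⟩
  · intro u v u' v' hr
    have := congrArg Prod.fst (congrFun (congrFun (hr 0) 0) 1)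
    exact iff_of_eq this
  · intro u v u' v' hr
    have := congrArg Prod.snd (congrFun (congrFun (hr 0) 0) 1)
    exact iff_of_eq this
  · intro u v u' v' hr
    obtain ⟨f, hf⟩ := exists_equiv_forall_nat
      (fun i (f : V ≃ W) => ∀ w, wlTupleColor G 2 i ![w, v] = wlTupleColor H 2 i ![f w, v'] ∧
        wlTupleColor G 2 i ![u, w] = wlTupleColor H 2 i ![u', f w])
      (fun i j f hij hf w => ⟨wlTupleColor_eq_of_le hij (hf w).1,
        wlTupleColor_eq_of_le hij (hf w).2⟩)
      (by
        intro i
        obtain ⟨f, hf⟩ := exists_equiv_of_map_univ_eq _ _ (congrArg Prod.snd (hr (i + 1)))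
        refine ⟨f, fun w => ⟨?_, ?_⟩⟩
        · have := congrFun (hf w) 0
          simp only [hu0, hu0'] at this
          exact this.symm
        · have := congrFun (hf w) 1
          simp only [hu1, hu1'] at this
          exact this.symm)
    exact ⟨f, fun w => ⟨fun i => (hf i w).1, fun i => (hf i w).2⟩⟩
  · intro u v
    refine ⟨F ![u, v] 0, F ![u, v] 1, fun i => ?_⟩
    rw [← heta', hF]
  · intro u' v'
    refine ⟨F.symm ![u', v'] 0, F.symm ![u', v'] 1, fun i => ?_⟩
    rw [← heta, ← hF, F.apply_symm_apply]

namespace PairBisim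

variable {V W : Type*} {G : SimpleGraph V} {H : SimpleGraph W}

/-- Precomposition of a bisimulation with a graph isomorphism. -/
def compIso {U : Type*} {G' : SimpleGraph U} (e : G' ≃g G) (R : PairBisim G H) :
    PairBisim G' H where
  rel u v := R.rel (e u) (e v)
  eq_iff h := by rw [← R.eq_iff h, e.injective.eq_iff]
  adj_iff h := by rw [← R.adj_iff h, e.map_adj_iff]
  step h := by
    obtain ⟨f, hf⟩ := R.step h
    exact ⟨e.toEquiv.trans f, fun w => hf (e w)⟩
  left_total u v := R.left_total _ _
  right_total u' v' := by
    obtain ⟨u, v, h⟩ := R.right_total u' v'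
    exact ⟨e.symm u, e.symm v, by simpa using h⟩

/-- Two binary functions (or relations) on the vertices of `G` and `H` correspond under the
bisimulation `R` if they agree on related pairs. This is the case for relations that are defined
in `G` and `H` by the same formula of three-variable counting logic. -/
def Inv (R : PairBisim G H) {α : Type*} (φ : V → V → α) (ψ : W → W → α) : Prop :=
  ∀ ⦃u v u' v'⦄, R.rel u v u' v' → φ u v = ψ u' v'

variable (R : PairBisim G H) {α β γ : Type*}

theorem inv_const (a : α) : R.Inv (fun _ _ => a) (fun _ _ => a) := fun _ _ _ _ _ => rfl

theorem inv_eq : R.Inv (fun u v => u = v) (fun u v => u = v) :=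
  fun _ _ _ _ h => propext (R.eq_iff h)

theorem inv_adj : R.Inv G.Adj H.Adj := fun _ _ _ _ h => propext (R.adj_iff h)

variable {R} {φ : V → V → α} {ψ : W → W → α} {φ' : V → V → β} {ψ' : W → W → β}

theorem Inv.map (h : R.Inv φ ψ) (g : α → γ) :
    R.Inv (fun u v => g (φ u v)) (fun u v => g (ψ u v)) :=
  fun _ _ _ _ hr => congrArg g (h hr)

theorem Inv.map₂ (h : R.Inv φ ψ) (h' : R.Inv φ' ψ') (g : α → β → γ) :
    R.Inv (fun u v => g (φ u v) (φ' u v)) (fun u v => g (ψ u v) (ψ' u v)) :=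
  fun _ _ _ _ hr => congrArg₂ g (h hr) (h' hr)

theorem Inv.sum [Fintype V] [Fintype W] [AddCommMonoid γ] (h : R.Inv φ ψ) (h' : R.Inv φ' ψ')
    (g : α → β → γ) :
    R.Inv (fun u v => ∑ w, g (φ u w) (φ' w v)) (fun u v => ∑ w, g (ψ u w) (ψ' w v)) := by
  intro u v u' v' hr
  obtain ⟨f, hf⟩ := R.step hr
  exact Fintype.sum_equiv f _ _ fun w => congrArg₂ g (h (hf w).2) (h' (hf w).1)

theorem Inv.exists (h : R.Inv φ ψ) (h' : R.Inv φ' ψ') (g : α → β → Prop) :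
    R.Inv (fun u v => ∃ w, g (φ u w) (φ' w v)) (fun u v => ∃ w, g (ψ u w) (ψ' w v)) := by
  intro u v u' v' hr
  obtain ⟨f, hf⟩ := R.step hr
  refine propext (f.exists_congr fun w => ?_)
  rw [h (hf w).2, h' (hf w).1]

theorem Inv.forall (h : R.Inv φ ψ) (h' : R.Inv φ' ψ') (g : α → β → Prop) :
    R.Inv (fun u v => ∀ w, g (φ u w) (φ' w v)) (fun u v => ∀ w, g (ψ u w) (ψ' w v)) := by
  intro u v u' v' hr
  obtain ⟨f, hf⟩ := R.step hr
  refine propext (f.forall_congr fun w => ?_)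
  rw [h (hf w).2, h' (hf w).1]

theorem Inv.ncard (h : R.Inv φ ψ) (h' : R.Inv φ' ψ') (g : α → β → Prop) :
    R.Inv (fun u v => {w | g (φ u w) (φ' w v)}.ncard)
      (fun u v => {w | g (ψ u w) (ψ' w v)}.ncard) := by
  intro u v u' v' hr
  obtain ⟨f, hf⟩ := R.step hr
  have : {w | g (ψ u' w) (ψ' w v')} = f '' {w | g (φ u w) (φ' w v)} := by
    ext w
    rw [Equiv.image_eq_preimage_symm, Set.mem_preimage, Set.mem_ofPred_eq, Set.mem_ofPred_eq,
      h (hf _).2, h' (hf _).1, f.apply_symm_apply]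
  simp only [this]
  exact (Set.ncard_image_of_injective _ f.injective).symm

/-- A property that holds for all pairs of vertices of `G` holds for all pairs of vertices
of `H`. -/
theorem Inv.transfer (h : R.Inv φ ψ) {p : α → Prop} (hp : ∀ u v, p (φ u v)) (u v : W) :
    p (ψ u v) := by
  obtain ⟨u₀, v₀, hr⟩ := R.right_total u v
  exact h hr ▸ hp u₀ v₀

/-- The three-variable form of `Inv.transfer`. -/
theorem Inv.transfer₃ (h : R.Inv φ ψ) (h' : R.Inv φ' ψ') {χ : V → V → γ} {ω : W → W → γ}
    (h'' : R.Inv χ ω) {p : α → β → γ → Prop}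
    (hp : ∀ u w v, p (φ u w) (φ' w v) (χ u v)) (u w v : W) : p (ψ u w) (ψ' w v) (ω u v) := by
  obtain ⟨u₀, v₀, hr⟩ := R.right_total u v
  obtain ⟨f, hf⟩ := R.step hr
  have := hp u₀ (f.symm w) v₀
  rwa [h (hf _).2, h' (hf _).1, h'' hr, f.apply_symm_apply] at this

theorem nonempty_equiv (R : PairBisim G H) [Nonempty V] : Nonempty (V ≃ W) := by
  obtain ⟨v⟩ := ‹Nonempty V›
  obtain ⟨u', v', h⟩ := R.left_total v v
  exact ⟨(R.step h).choose⟩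

end PairBisim

/-! ### Colour refinement on regular graphs -/

theorem not_wlDistinguishes_one {V W : Type*} [Fintype V] [Fintype W] {G : SimpleGraph V}
    {H : SimpleGraph W} (hcard : Fintype.card V = Fintype.card W) {d : ℕ}
    (hG : ∀ v, {w | G.Adj v w}.ncard = d) (hH : ∀ v, {w | H.Adj v w}.ncard = d) :
    ¬ WLDistinguishes 1 G H := by
  classical
  have key : ∀ i, ∃ c, (∀ v, wlVertexColor G i v = c) ∧ (∀ w, wlVertexColor H i w = c) := by
    intro i
    induction i with
    | zero => exact ⟨(), fun _ => rfl, fun _ => rfl⟩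
    | succ i ih =>
      obtain ⟨c, hc, hc'⟩ := ih
      refine ⟨(c, Multiset.replicate d c), fun v => ?_, fun v => ?_⟩
      · rw [wlVertexColor, hc]
        refine congrArg _ (Multiset.eq_replicate.2 ⟨?_, ?_⟩)
        · rw [Multiset.card_map, ← hG v, Set.ncard_eq_toFinset_card', Finset.card_def]
          congr 2
          ext
          simp
        · intro b hb
          obtain ⟨w, -, rfl⟩ := Multiset.mem_map.1 hb
          exact hc w
      · rw [wlVertexColor, hc']
        refine congrArg _ (Multiset.eq_replicate.2 ⟨?_, ?_⟩)
        · rw [Multiset.card_map, ← hH v, Set.ncard_eq_toFinset_card', Finset.card_def]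
          congr 2
          ext
          simp
        · intro b hb
          obtain ⟨w, -, rfl⟩ := Multiset.mem_map.1 hb
          exact hc' w
  simp only [WLDistinguishes, if_true, not_exists, not_not]
  intro i
  obtain ⟨c, hc, hc'⟩ := key i
  have h1 : (Finset.univ : Finset V).val.map (wlVertexColor G i) =
      Multiset.replicate (Fintype.card V) c := by
    rw [Multiset.map_congr rfl fun v _ => hc v, Multiset.map_const']
    rfl
  have h2 : (Finset.univ : Finset W).val.map (wlVertexColor H i) =
      Multiset.replicate (Fintype.card W) c := by
    rw [Multiset.map_congr rfl fun v _ => hc' v, Multiset.map_const']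
    rfl
  rw [h1, h2, hcard]

/-- The criterion for dimension two used throughout: a regular graph that is not determined among
regular graphs by its order and degree, but is determined by its 2-dimensional stable colouring. -/
theorem wlDim_eq_two {V : Type*} [Fintype V] {G : SimpleGraph V}
    {W : Type} [Fintype W] {H : SimpleGraph W} (hcard : Fintype.card V = Fintype.card W) {d : ℕ}
    (hG : ∀ v, {w | G.Adj v w}.ncard = d) (hH : ∀ v, {w | H.Adj v w}.ncard = d)
    (hGH : ¬ Nonempty (G ≃g H))
    (hident : ∀ (W : Type) [Fintype W] (H : SimpleGraph W), PairBisim G H → Nonempty (G ≃g H)) :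
    wlDim G = 2 := by
  have h2 : 2 ∈ {d : ℕ | 1 ≤ d ∧ WLIdentifies d G} := by
    refine ⟨by norm_num, fun W _ H hn => ?_⟩
    by_contra h
    exact hn (hident W H (nonempty_pairBisim h).some)
  refine le_antisymm (Nat.sInf_le h2) (le_csInf ⟨2, h2⟩ ?_)
  rintro e ⟨he, hid⟩
  by_contra hlt
  obtain rfl : e = 1 := by omega
  exact not_wlDistinguishes_one hcard hG hH (hid W H hGH)

/-! ### Disjoint unions of incidence graphs of symmetric designs -/

/-- `I` is the incidence relation of a symmetric `2-(n, k, l)` design with point set `P` and block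
set `B`. The dual conditions, which are consequences of the others, are part of the definition. -/
structure IsSymDesign {P B : Type*} (I : P → B → Prop) (n k l : ℕ) : Prop where
  card_points : Nat.card P = n
  card_blocks : Nat.card B = n
  block_size : ∀ b, {p | I p b}.ncard = k
  point_degree : ∀ p, {b | I p b}.ncard = k
  points_common : ∀ p p', p ≠ p' → {b | I p b ∧ I p' b}.ncard = l
  blocks_common : ∀ b b', b ≠ b' → {p | I p b ∧ I p b'}.ncard = l

/-- Any two symmetric `2-(n, k, l)` designs are isomorphic. -/
def UniqueSymDesign (n k l : ℕ) : Prop :=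
  ∀ ⦃P B P' B' : Type⦄ (I : P → B → Prop) (I' : P' → B' → Prop),
    IsSymDesign I n k l → IsSymDesign I' n k l →
      ∃ (e : P ≃ P') (f : B ≃ B'), ∀ p b, I p b ↔ I' (e p) (f b)

/-- Adjacency in the incidence graph of `I`. -/
def incidenceAdj {P B : Type*} (I : P → B → Prop) : P ⊕ B → P ⊕ B → Prop
  | Sum.inl p, Sum.inr b => I p b
  | Sum.inr b, Sum.inl p => I p b
  | _, _ => False

/-- Two vertices are joined if they are equal or have a common neighbour. -/
def EqOrMeet {V : Type*} (K : SimpleGraph V) (u v : V) : Prop :=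
  u = v ∨ ∃ w, K.Adj u w ∧ K.Adj w v

/-- Three-variable axioms that characterise the disjoint unions of incidence graphs of symmetric
`2-(n, k, l)` designs, `k ≥ 1`. -/
structure IsIncidenceUnion {V : Type*} (K : SimpleGraph V) (n k l : ℕ) : Prop where
  degree : ∀ u, {w | K.Adj u w}.ncard = k
  no_triangle : ∀ u w v, K.Adj u w → K.Adj w v → ¬ K.Adj u v
  trans : ∀ u w v, EqOrMeet K u w → EqOrMeet K w v → EqOrMeet K u v
  class_card : ∀ u, {w | EqOrMeet K u w}.ncard = n
  common : ∀ u v, EqOrMeet K u v → u ≠ v → {w | K.Adj u w ∧ K.Adj w v}.ncard = l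

theorem EqOrMeet.symm {V : Type*} {K : SimpleGraph V} {u v : V} (h : EqOrMeet K u v) :
    EqOrMeet K v u := by
  rcases h with rfl | ⟨w, h, h'⟩
  · exact Or.inl rfl
  · exact Or.inr ⟨w, h'.symm, h.symm⟩

theorem ncard_subtype_setOf {V : Type*} {q A : V → Prop} (h : ∀ w, A w → q w) :
    {b : {w // q w} | A b}.ncard = {w | A w}.ncard := by
  rw [← Set.ncard_image_of_injective _ Subtype.val_injective]
  congr 1
  ext w
  constructor
  · rintro ⟨b, hb, rfl⟩
    exact hb
  · intro hw
    exact ⟨⟨w, h w hw⟩, hw, rfl⟩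

namespace IsIncidenceUnion

variable {V : Type*} {K : SimpleGraph V} {n k l : ℕ}

theorem not_eqOrMeet (h : IsIncidenceUnion K n k l) {u v : V} (huv : K.Adj u v) :
    ¬ EqOrMeet K u v := by
  rintro (rfl | ⟨w, h1, h2⟩)
  · exact K.irrefl huv
  · exact h.no_triangle u w v h1 h2 huv

theorem eqOrMeet_of_adj (h : IsIncidenceUnion K n k l) {v b p w : V} (hvb : K.Adj v b)
    (hp : EqOrMeet K v p) (hpw : K.Adj p w) : EqOrMeet K b w := by
  rcases hp with rfl | ⟨z, h1, h2⟩
  · exact Or.inr ⟨v, hvb.symm, hpw⟩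
  · exact h.trans b z w (Or.inr ⟨v, hvb.symm, h1⟩) (Or.inr ⟨p, h2, hpw⟩)

/-- The points and blocks of a component: the vertices joined to `v` and those joined to a
neighbour `b` of `v`. -/
theorem isSymDesign (h : IsIncidenceUnion K n k l) {v b : V} (hvb : K.Adj v b) :
    IsSymDesign (fun (p : {p // EqOrMeet K v p}) (q : {q // EqOrMeet K b q}) => K.Adj p q)
      n k l where
  card_points := h.class_card v
  card_blocks := h.class_card b
  block_size q := by
    rw [ncard_subtype_setOf (A := fun p => K.Adj p q)
      fun w hw => h.eqOrMeet_of_adj hvb.symm q.2 hw.symm]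
    simpa only [K.adj_comm] using h.degree q
  point_degree p := by
    rw [ncard_subtype_setOf (A := fun q => K.Adj p q) fun w hw => h.eqOrMeet_of_adj hvb p.2 hw]
    exact h.degree p
  points_common p p' hpp' := by
    rw [ncard_subtype_setOf (A := fun q => K.Adj p q ∧ K.Adj p' q)
      fun w hw => h.eqOrMeet_of_adj hvb p.2 hw.1]
    simpa only [K.adj_comm p'.1] using
      h.common p p' (h.trans _ v _ p.2.symm p'.2) fun e => hpp' (Subtype.ext e)
  blocks_common q q' hqq' := by
    rw [ncard_subtype_setOf (A := fun p => K.Adj p q ∧ K.Adj p q')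
      fun w hw => h.eqOrMeet_of_adj hvb.symm q.2 hw.1.symm]
    simpa only [K.adj_comm q.1] using
      h.common q q' (h.trans _ b _ q.2.symm q'.2) fun e => hqq' (Subtype.ext e)

/-- Every connected component is the incidence graph of a symmetric design. -/
theorem exists_model {V : Type} {K : SimpleGraph V} (h : IsIncidenceUnion K n k l) (hk : 0 < k)
    (c : K.ConnectedComponent) :
    ∃ (P B : Type) (I : P → B → Prop) (e : P ⊕ B ≃ {u // K.connectedComponentMk u = c}),
      IsSymDesign I n k l ∧ ∀ x y, K.Adj (e x) (e y) ↔ incidenceAdj I x y := by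
  induction c using SimpleGraph.ConnectedComponent.ind with | _ v
  obtain ⟨b, hvb⟩ : ∃ b, K.Adj v b := by
    have : {w | K.Adj v w}.Nonempty := Set.nonempty_of_ncard_ne_zero (by rw [h.degree]; omega)
    exact this
  have hreach : ∀ {x y}, EqOrMeet K x y → K.Reachable x y := by
    rintro x y (rfl | ⟨w, h1, h2⟩)
    · exact SimpleGraph.Reachable.refl x
    · exact h1.reachable.trans h2.reachable
  have hcover : ∀ u, K.Reachable v u → EqOrMeet K v u ∨ EqOrMeet K b u := by
    rintro u ⟨p⟩
    suffices H : ∀ x y (p : K.Walk x y), (EqOrMeet K v x ∨ EqOrMeet K b x) →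
        (EqOrMeet K v y ∨ EqOrMeet K b y) from H v u p (Or.inl (Or.inl rfl))
    intro x y p
    induction p with
    | nil => exact id
    | cons hadj _ ih =>
      rintro (hx | hx)
      · exact ih (Or.inr (h.eqOrMeet_of_adj hvb hx hadj))
      · exact ih (Or.inl (h.eqOrMeet_of_adj hvb.symm hx hadj))
  have hdisj : ∀ u, EqOrMeet K v u → EqOrMeet K b u → False := fun u h1 h2 =>
    h.not_eqOrMeet hvb (h.trans _ u _ h1 h2.symm)
  let f : {p // EqOrMeet K v p} ⊕ {q // EqOrMeet K b q} →
      {u // K.connectedComponentMk u = K.connectedComponentMk v} :=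
    Sum.elim (fun p => ⟨p.1, SimpleGraph.ConnectedComponent.eq.2 (hreach p.2.symm)⟩)
      (fun q => ⟨q.1, SimpleGraph.ConnectedComponent.eq.2
        ((hreach q.2.symm).trans hvb.symm.reachable)⟩)
  have hf : Function.Bijective f := by
    constructor
    · rintro (x | x) (y | y) hxy
      · exact congrArg _ (Subtype.ext (congrArg Subtype.val hxy :))
      · have : x.1 = y.1 := congrArg Subtype.val hxy
        exact (hdisj y.1 (this ▸ x.2) y.2).elim
      · have : x.1 = y.1 := congrArg Subtype.val hxy
        exact (hdisj y.1 y.2 (this ▸ x.2)).elim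
      · exact congrArg _ (Subtype.ext (congrArg Subtype.val hxy :))
    · rintro ⟨u, hu⟩
      rcases hcover u (SimpleGraph.ConnectedComponent.eq.1 hu).symm with h1 | h1
      · exact ⟨Sum.inl ⟨u, h1⟩, rfl⟩
      · exact ⟨Sum.inr ⟨u, h1⟩, rfl⟩
  refine ⟨_, _, _, Equiv.ofBijective f hf, h.isSymDesign hvb, ?_⟩
  rintro (x | x) (y | y)
  · exact iff_of_false (fun hadj => h.not_eqOrMeet hadj (h.trans _ v _ x.2.symm y.2)) id
  · exact Iff.rfl
  · exact K.adj_comm _ _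
  · exact iff_of_false (fun hadj => h.not_eqOrMeet hadj (h.trans _ b _ x.2.symm y.2)) id

/-- If the symmetric design is unique, then a disjoint union of its incidence graphs is determined
by its order. -/
theorem nonempty_iso (hU : UniqueSymDesign n k l) (hk : 0 < k) {V W : Type} [Finite V] [Finite W]
    {K : SimpleGraph V} {L : SimpleGraph W} (hK : IsIncidenceUnion K n k l)
    (hL : IsIncidenceUnion L n k l) (hcard : Nat.card V = Nat.card W) : Nonempty (K ≃g L) := by
  rcases isEmpty_or_nonempty V with hV | hV
  · have : IsEmpty W := by
      rw [Nat.card_of_isEmpty] at hcard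
      rcases Nat.card_eq_zero.1 hcard.symm with h | h
      · exact h
      · exact (not_finite W).elim
    exact ⟨⟨Equiv.equivOfIsEmpty V W, fun {a} => isEmptyElim a⟩⟩
  have hn : 0 < n := by
    obtain ⟨v⟩ := hV
    rw [← hK.class_card v]
    exact (Set.ncard_pos (Set.toFinite _)).2 ⟨v, Or.inl rfl⟩
  have hsize : ∀ {V : Type} [Finite V] {K : SimpleGraph V}, IsIncidenceUnion K n k l →
      ∀ c : K.ConnectedComponent, Nat.card {u // K.connectedComponentMk u = c} = 2 * n := by
    intro V _ K hK c
    obtain ⟨P, B, I, e, hI, -⟩ := hK.exists_model hk c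
    have : Finite P := Nat.finite_of_card_ne_zero (by rw [hI.card_points]; omega)
    have : Finite B := Nat.finite_of_card_ne_zero (by rw [hI.card_blocks]; omega)
    rw [← Nat.card_congr e, Nat.card_sum, hI.card_points, hI.card_blocks, two_mul]
  have hcount : ∀ {V : Type} [Finite V] {K : SimpleGraph V}, IsIncidenceUnion K n k l →
      Nat.card V = Nat.card K.ConnectedComponent * (2 * n) := by
    intro V _ K hK
    have := Fintype.ofFinite K.ConnectedComponent
    rw [Nat.card_congr (Equiv.sigmaFiberEquiv K.connectedComponentMk).symm, Nat.card_sigma,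
      Finset.sum_congr rfl fun c _ => hsize hK c, Finset.sum_const, Nat.card_eq_fintype_card,
      smul_eq_mul, Finset.card_univ]
  have hcomp : Nat.card K.ConnectedComponent = Nat.card L.ConnectedComponent :=
    Nat.eq_of_mul_eq_mul_right (by omega) ((hcount hK).symm.trans (hcard.trans (hcount hL)))
  obtain ⟨σ⟩ : Nonempty (K.ConnectedComponent ≃ L.ConnectedComponent) :=
    Finite.card_eq.1 hcomp
  have hiso : ∀ c : K.ConnectedComponent,
      ∃ e : {u // K.connectedComponentMk u = c} ≃ {u // L.connectedComponentMk u = σ c},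
        ∀ x y : {u // K.connectedComponentMk u = c}, K.Adj x y ↔ L.Adj (e x) (e y) := by
    intro c
    obtain ⟨P, B, I, e, hI, he⟩ := hK.exists_model hk c
    obtain ⟨P', B', I', e', hI', he'⟩ := hL.exists_model hk (σ c)
    obtain ⟨α, β, hαβ⟩ := hU I I' hI hI'
    refine ⟨e.symm.trans ((Equiv.sumCongr α β).trans e'), fun x y => ?_⟩
    obtain ⟨x, rfl⟩ := e.surjective x
    obtain ⟨y, rfl⟩ := e.surjective y
    rw [he]
    simp only [Equiv.trans_apply, Equiv.symm_apply_apply]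
    rw [he']
    rcases x with x | x <;> rcases y with y | y <;> simp [incidenceAdj, hαβ]
  choose e he using hiso
  let f : V ≃ W := (Equiv.sigmaFiberEquiv K.connectedComponentMk).symm.trans
    ((Equiv.sigmaCongr σ e).trans (Equiv.sigmaFiberEquiv L.connectedComponentMk))
  have hfe : ∀ (c : K.ConnectedComponent) (x : {u // K.connectedComponentMk u = c}),
      f x = e c x := by
    rintro _ ⟨x, rfl⟩
    rfl
  have hfc : ∀ v, L.connectedComponentMk (f v) = σ (K.connectedComponentMk v) := fun v =>
    (e _ ⟨v, rfl⟩).2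
  refine ⟨⟨f, fun {u v} => ?_⟩⟩
  by_cases huv : K.connectedComponentMk u = K.connectedComponentMk v
  · have h1 := hfe _ ⟨u, huv⟩
    have h2 := hfe _ ⟨v, rfl⟩
    simp only at h1 h2
    rw [h1, h2, ← he]
  · refine iff_of_false (fun hadj => huv ?_) (fun hadj => huv ?_)
    · have := SimpleGraph.ConnectedComponent.eq.2 hadj.reachable
      rw [hfc, hfc] at this
      exact σ.injective this
    · exact SimpleGraph.ConnectedComponent.eq.2 hadj.reachable

end IsIncidenceUnion

namespace PairBisim

variable {V W : Type*} {G : SimpleGraph V} {H : SimpleGraph W}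

theorem inv_compl_adj (R : PairBisim G H) : R.Inv Gᶜ.Adj Hᶜ.Adj := by
  intro u v u' v' hr
  rw [SimpleGraph.compl_adj, SimpleGraph.compl_adj, ne_eq, ne_eq, R.eq_iff hr, R.adj_iff hr]

theorem inv_eqOrMeet_compl (R : PairBisim G H) : R.Inv (EqOrMeet Gᶜ) (EqOrMeet Hᶜ) :=
  R.inv_eq.map₂ (R.inv_compl_adj.exists R.inv_compl_adj And) Or

theorem isIncidenceUnion (R : PairBisim G H) {n k l : ℕ} (h : IsIncidenceUnion Gᶜ n k l) :
    IsIncidenceUnion Hᶜ n k l where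
  degree u := by
    have := (R.inv_compl_adj.ncard (R.inv_const True) And).transfer (p := fun x => x = k)
      (fun u _ => by simpa using h.degree u) u u
    simpa using this
  no_triangle := R.inv_compl_adj.transfer₃ R.inv_compl_adj R.inv_compl_adj
    (p := fun a b c => a → b → ¬ c) h.no_triangle
  trans := R.inv_eqOrMeet_compl.transfer₃ R.inv_eqOrMeet_compl R.inv_eqOrMeet_compl
    (p := fun a b c => a → b → c) h.trans
  class_card u := by
    have := (R.inv_eqOrMeet_compl.ncard (R.inv_const True) And).transfer (p := fun x => x = n)
      (fun u _ => by simpa using h.class_card u) u u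
    simpa using this
  common := (R.inv_eqOrMeet_compl.map₂ (R.inv_eq.map₂
    (R.inv_compl_adj.ncard R.inv_compl_adj And) Prod.mk) Prod.mk).transfer
    (p := fun x => x.1 → ¬ x.2.1 → x.2.2 = l) h.common

/-- The graph of an isomorphism, as a bisimulation. -/
def ofIso (e : G ≃g H) : PairBisim G H where
  rel u v u' v' := e u = u' ∧ e v = v'
  eq_iff := by
    rintro u v _ _ ⟨rfl, rfl⟩
    exact e.injective.eq_iff.symm
  adj_iff := by
    rintro u v _ _ ⟨rfl, rfl⟩
    exact e.map_adj_iff.symm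
  step := by
    rintro u v _ _ ⟨rfl, rfl⟩
    exact ⟨e.toEquiv, fun w => ⟨⟨rfl, rfl⟩, rfl, rfl⟩⟩
  left_total u v := ⟨_, _, rfl, rfl⟩
  right_total u' v' := ⟨e.symm u', e.symm v', by simp⟩

end PairBisim

theorem nonempty_iso_of_compl {V W : Type*} {G : SimpleGraph V} {H : SimpleGraph W}
    (h : Nonempty (Gᶜ ≃g Hᶜ)) : Nonempty (G ≃g H) := by
  obtain ⟨e⟩ := h
  refine ⟨⟨e.toEquiv, fun {a b} => ?_⟩⟩
  have h1 : Hᶜ.Adj (e a) (e b) ↔ Gᶜ.Adj a b := e.map_adj_iff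
  rw [SimpleGraph.compl_adj, SimpleGraph.compl_adj, e.injective.ne_iff] at h1
  change H.Adj (e a) (e b) ↔ G.Adj a b
  by_cases hab : a = b
  · simp [hab]
  · tauto

theorem ncard_adj_of_compl {V : Type*} [Fintype V] {G : SimpleGraph V} {k : ℕ}
    (h : ∀ v, {w | Gᶜ.Adj v w}.ncard = k) (v : V) :
    {w | G.Adj v w}.ncard = Fintype.card V - (k + 1) := by
  have h1 : {w | G.Adj v w} = (insert v {w | Gᶜ.Adj v w})ᶜ := by
    ext w
    by_cases hvw : v = w
    · simp [hvw]
    · simp [hvw, Ne.symm hvw]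
  have h2 : (insert v {w | Gᶜ.Adj v w}).ncard = k + 1 := by
    rw [Set.ncard_insert_of_notMem (by simp), h]
  have h3 := Set.ncard_add_ncard_compl (insert v {w | Gᶜ.Adj v w})
  rw [← h1, h2, Nat.card_eq_fintype_card] at h3
  omega

/-! ### Lexicographic products with complete graphs -/

section LexProduct

variable {m : ℕ} {X : Type*} {Y : SimpleGraph X}

theorem compl_lexProductGraph_adj (p q : Fin m × X) :
    (lexProductGraph (SimpleGraph.completeGraph (Fin m)) Y)ᶜ.Adj p q ↔
      p.1 = q.1 ∧ Yᶜ.Adj p.2 q.2 := by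
  simp only [SimpleGraph.compl_adj, lexProductGraph, SimpleGraph.completeGraph,
    SimpleGraph.top_adj, ne_eq, Prod.ext_iff]
  tauto

theorem eqOrMeet_compl_lexProductGraph (p q : Fin m × X) :
    EqOrMeet (lexProductGraph (SimpleGraph.completeGraph (Fin m)) Y)ᶜ p q ↔
      p.1 = q.1 ∧ EqOrMeet Yᶜ p.2 q.2 := by
  simp only [EqOrMeet, compl_lexProductGraph_adj, Prod.ext_iff]
  constructor
  · rintro (⟨h1, h2⟩ | ⟨w, ⟨h1, h2⟩, h3, h4⟩)
    · exact ⟨h1, Or.inl h2⟩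
    · exact ⟨h1.trans h3, Or.inr ⟨_, h2, h4⟩⟩
  · rintro ⟨h1, h2 | ⟨w, h2, h4⟩⟩
    · exact Or.inl ⟨h1, h2⟩
    · exact Or.inr ⟨(p.1, w), ⟨rfl, h2⟩, h1, h4⟩

theorem ncard_setOf_fst_eq (a : Fin m) (A : X → Prop) :
    {w : Fin m × X | a = w.1 ∧ A w.2}.ncard = {x | A x}.ncard := by
  rw [← Set.ncard_image_of_injective {x | A x} (Prod.mk_right_injective a)]
  congr 1
  ext ⟨b, x⟩
  simp
  tauto

theorem IsIncidenceUnion.lexProductGraph {n k l : ℕ} (h : IsIncidenceUnion Yᶜ n k l) :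
    IsIncidenceUnion (lexProductGraph (SimpleGraph.completeGraph (Fin m)) Y)ᶜ n k l where
  degree u := by
    simp only [compl_lexProductGraph_adj]
    rw [ncard_setOf_fst_eq, h.degree]
  no_triangle u w v := by
    simp only [compl_lexProductGraph_adj]
    exact fun h1 h2 h3 => h.no_triangle _ _ _ h1.2 h2.2 h3.2
  trans u w v := by
    simp only [eqOrMeet_compl_lexProductGraph]
    exact fun h1 h2 => ⟨h1.1.trans h2.1, h.trans _ _ _ h1.2 h2.2⟩
  class_card u := by
    simp only [eqOrMeet_compl_lexProductGraph]
    rw [ncard_setOf_fst_eq, h.class_card]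
  common u v := by
    simp only [eqOrMeet_compl_lexProductGraph, compl_lexProductGraph_adj]
    rintro ⟨h1, h2⟩ h3
    rw [← h.common u.2 v.2 h2 fun h4 => h3 (Prod.ext h1 h4),
      ← ncard_setOf_fst_eq u.1 fun x => Yᶜ.Adj u.2 x ∧ Yᶜ.Adj x v.2]
    refine congrArg Set.ncard ?_
    ext w
    simp only [Set.mem_ofPred_eq]
    constructor
    · exact fun ⟨⟨h5, h6⟩, h7, h8⟩ => ⟨h5, h6, h8⟩
    · exact fun ⟨h5, h6, h8⟩ => ⟨⟨h5, h6⟩, h5.symm.trans h1, h8⟩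

end LexProduct

/-- `K_m[Y]` has dimension two if the complement of `Y` is a disjoint union of incidence graphs of a
unique symmetric design. The graph `K_m[Y']` is the regular graph of the same order and degree for
the lower bound: the number of common neighbours of `x` and `y` in the complement of `Y'` does not
occur in a union of incidence graphs of such designs. -/
theorem wlDim_lexProductGraph_eq_two {X X' : Type} [Fintype X] [Fintype X'] {Y : SimpleGraph X}
    {Y' : SimpleGraph X'} (hcard : Fintype.card X = Fintype.card X') {n k l : ℕ}
    (hU : UniqueSymDesign n k l) (hk : 0 < k) (h : IsIncidenceUnion Yᶜ n k l)
    (hdeg : ∀ x, {w | Y'ᶜ.Adj x w}.ncard = k) {x y : X'} (hxy : x ≠ y)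
    (h0 : {w | Y'ᶜ.Adj x w ∧ Y'ᶜ.Adj w y}.ncard ≠ 0)
    (hl : {w | Y'ᶜ.Adj x w ∧ Y'ᶜ.Adj w y}.ncard ≠ l) {m : ℕ} (hm : 1 ≤ m) :
    wlDim (lexProductGraph (SimpleGraph.completeGraph (Fin m)) Y) = 2 := by
  have hlex := h.lexProductGraph (m := m)
  have hdeg' : ∀ v, {w | (lexProductGraph (SimpleGraph.completeGraph (Fin m)) Y')ᶜ.Adj v w}.ncard
      = k := by
    intro v
    simp only [compl_lexProductGraph_adj]
    rw [ncard_setOf_fst_eq, hdeg]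
  have hcard' : Fintype.card (Fin m × X) = Fintype.card (Fin m × X') := by
    rw [Fintype.card_prod, Fintype.card_prod, hcard]
  refine wlDim_eq_two (H := lexProductGraph (SimpleGraph.completeGraph (Fin m)) Y')
    (d := Fintype.card (Fin m × X) - (k + 1)) hcard' (ncard_adj_of_compl hlex.degree)
    (fun v => by rw [hcard', ncard_adj_of_compl hdeg']) ?_ ?_
  · rintro ⟨e⟩
    have h2 := (PairBisim.ofIso e).isIncidenceUnion hlex
    let i : Fin m := ⟨0, hm⟩
    have hset : {w | (lexProductGraph (SimpleGraph.completeGraph (Fin m)) Y')ᶜ.Adj (i, x) w ∧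
        (lexProductGraph (SimpleGraph.completeGraph (Fin m)) Y')ᶜ.Adj w (i, y)} =
        {w | i = w.1 ∧ (Y'ᶜ.Adj x w.2 ∧ Y'ᶜ.Adj w.2 y)} := by
      ext w
      simp only [compl_lexProductGraph_adj, Set.mem_ofPred_eq]
      tauto
    obtain ⟨z, hz⟩ := Set.nonempty_of_ncard_ne_zero h0
    refine hl ?_
    rw [← h2.common (i, x) (i, y) ((eqOrMeet_compl_lexProductGraph _ _).2 ⟨rfl, Or.inr ⟨z, hz⟩⟩)
      (by simpa using hxy), hset, ncard_setOf_fst_eq i (fun w => Y'ᶜ.Adj x w ∧ Y'ᶜ.Adj w y)]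
  · intro W _ H R
    have : Nonempty X := Fintype.card_pos_iff.1 (hcard ▸ Fintype.card_pos_iff.2 ⟨x⟩)
    have : Nonempty (Fin m × X) := ⟨(⟨0, hm⟩, Classical.arbitrary X)⟩
    obtain ⟨f⟩ := R.nonempty_equiv
    exact nonempty_iso_of_compl
      (IsIncidenceUnion.nonempty_iso hU hk hlex (R.isIncidenceUnion hlex) (Nat.card_congr f))

/-! ### Uniqueness of small symmetric designs -/

namespace IsSymDesign

variable {P B : Type*} {I : P → B → Prop} {n k l : ℕ}

/-- An incidence-preserving pair of maps to any incidence structure is injective. -/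
theorem injective_of_map (h : IsSymDesign I n k l) (hlk : l < k) {S T : Type*} {J : S → T → Prop}
    {φ : P → S} {ψ : B → T} (hφψ : ∀ p b, I p b ↔ J (φ p) (ψ b)) :
    Function.Injective φ ∧ Function.Injective ψ := by
  constructor
  · intro p p' hpp'
    by_contra hne
    have h1 := h.points_common p p' hne
    simp only [hφψ, hpp', and_self] at h1
    simp only [← hφψ, h.point_degree] at h1
    omega
  · intro b b' hbb'
    by_contra hne
    have h1 := h.blocks_common b b' hne
    simp only [hφψ, hbb', and_self] at h1
    simp only [← hφψ, h.block_size] at h1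
    omega

theorem finite_points (h : IsSymDesign I n k l) (hn : 0 < n) : Finite P :=
  Nat.finite_of_card_ne_zero (by rw [h.card_points]; omega)

theorem finite_blocks (h : IsSymDesign I n k l) (hn : 0 < n) : Finite B :=
  Nat.finite_of_card_ne_zero (by rw [h.card_blocks]; omega)

end IsSymDesign

/-- A symmetric design is unique if all designs with its parameters map to one incidence structure
of the right size. -/
theorem uniqueSymDesign_of_map {n k l : ℕ} (hn : 0 < n) (hlk : l < k) {S T : Type*} [Finite S]
    [Finite T] (J : S → T → Prop) (hS : Nat.card S ≤ n) (hT : Nat.card T ≤ n)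
    (h : ∀ ⦃P B : Type⦄ (I : P → B → Prop), IsSymDesign I n k l →
      ∃ (φ : P → S) (ψ : B → T), ∀ p b, I p b ↔ J (φ p) (ψ b)) : UniqueSymDesign n k l := by
  have key : ∀ ⦃P B : Type⦄ (I : P → B → Prop), IsSymDesign I n k l →
      ∃ (φ : P ≃ S) (ψ : B ≃ T), ∀ p b, I p b ↔ J (φ p) (ψ b) := by
    intro P B I hI
    obtain ⟨φ, ψ, hφψ⟩ := h I hI
    obtain ⟨h1, h2⟩ := hI.injective_of_map hlk hφψ
    have := hI.finite_points hn
    have := hI.finite_blocks hn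
    exact ⟨Equiv.ofBijective φ (h1.bijective_of_nat_card_le (hS.trans hI.card_points.ge)),
      Equiv.ofBijective ψ (h2.bijective_of_nat_card_le (hT.trans hI.card_blocks.ge)), hφψ⟩
  intro P B P' B' I I' hI hI'
  obtain ⟨φ, ψ, h1⟩ := key I hI
  obtain ⟨φ', ψ', h2⟩ := key I' hI'
  exact ⟨φ.trans φ'.symm, ψ.trans ψ'.symm, fun p b => by simp [h1, h2]⟩

theorem ncard_setOf_not {X : Type*} [Finite X] (A : X → Prop) :
    {x | ¬ A x}.ncard + {x | A x}.ncard = Nat.card X := by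
  rw [add_comm, ← Set.ncard_add_ncard_compl {x | A x}]
  rfl

theorem ncard_setOf_not_and_not {X : Type*} [Finite X] (A A' : X → Prop) :
    {x | ¬ A x ∧ ¬ A' x}.ncard + ({x | A x}.ncard + {x | A' x}.ncard) =
      Nat.card X + {x | A x ∧ A' x}.ncard := by
  have h1 := Set.ncard_union_add_ncard_inter {x | A x} {x | A' x}
  have h2 := ncard_setOf_not fun x => A x ∨ A' x
  simp only [not_or] at h2
  have h3 : {x | A x} ∪ {x | A' x} = {x | A x ∨ A' x} := rfl
  have h4 : {x | A x} ∩ {x | A' x} = {x | A x ∧ A' x} := rfl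
  rw [h3, h4] at h1
  omega

theorem IsSymDesign.compl {P B : Type*} {I : P → B → Prop} {n k l k' l' : ℕ} (hn : 0 < n)
    (hk : k + k' = n) (hl : l' + 2 * k = n + l) (h : IsSymDesign I n k l) :
    IsSymDesign (fun p b => ¬ I p b) n k' l' := by
  have := h.finite_points hn
  have := h.finite_blocks hn
  refine ⟨h.card_points, h.card_blocks, fun b => ?_, fun p => ?_, fun p p' hne => ?_,
    fun b b' hne => ?_⟩
  · have h1 := ncard_setOf_not fun p => I p b
    rw [h.block_size, h.card_points] at h1
    omega
  · have h1 := ncard_setOf_not fun b => I p b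
    rw [h.point_degree, h.card_blocks] at h1
    omega
  · have h1 := ncard_setOf_not_and_not (fun b => I p b) (fun b => I p' b)
    rw [h.point_degree, h.point_degree, h.points_common p p' hne, h.card_blocks] at h1
    omega
  · have h1 := ncard_setOf_not_and_not (fun p => I p b) (fun p => I p b')
    rw [h.block_size, h.block_size, h.blocks_common b b' hne, h.card_points] at h1
    omega

theorem UniqueSymDesign.compl {n k l k' l' : ℕ} (h : UniqueSymDesign n k l) (hn : 0 < n)
    (hk : k + k' = n) (hl : l' + 2 * k = n + l) : UniqueSymDesign n k' l' := by
  intro P B P' B' I I' hI hI'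
  obtain ⟨e, f, hef⟩ := h _ _ (hI.compl (k' := k) (l' := l) hn (by omega) (by omega))
    (hI'.compl (k' := k) (l' := l) hn (by omega) (by omega))
  exact ⟨e, f, fun p b => not_iff_not.1 (hef p b)⟩

theorem uniqueSymDesign_one_zero {n : ℕ} (hn : 0 < n) : UniqueSymDesign n 1 0 := by
  refine uniqueSymDesign_of_map hn one_pos (S := Fin n) (T := Fin n) (fun i j => i = j)
    (by simp) (by simp) ?_
  intro P B I hI
  have := hI.finite_points hn
  obtain ⟨e⟩ : Nonempty (P ≃ Fin n) := Finite.card_eq.1 (by rw [hI.card_points]; simp)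
  choose c hc using fun b => Set.ncard_eq_one.1 (hI.block_size b)
  refine ⟨e, fun b => e (c b), fun p b => ?_⟩
  rw [e.injective.eq_iff]
  exact Set.ext_iff.1 (hc b) p

/-! ### Coordinates in projective planes -/

/-- The incidence structure in which a projective plane of order `q` is coordinatised by a line
`none` with points `inl i`. The other lines through `inl i` are `some (i, c)`; a point off the
line `none` is the word whose letter `i` names the line that connects it to `inl i`. -/
def PlaneIncidence {q : ℕ} :
    Fin (q + 1) ⊕ (Fin (q + 1) → Fin q) → Option (Fin (q + 1) × Fin q) → Prop
  | Sum.inl _, none => True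
  | Sum.inl i, some (j, _) => i = j
  | Sum.inr _, none => False
  | Sum.inr w, some (j, c) => w j = c

/-- A coordinatisation of a projective plane of order `q`. -/
def IsPlaneModel {P B : Type*} {q : ℕ} (I : P → B → Prop)
    (φ : P → Fin (q + 1) ⊕ (Fin (q + 1) → Fin q)) (ψ : B → Option (Fin (q + 1) × Fin q)) : Prop :=
  ∀ p b, I p b ↔ PlaneIncidence (φ p) (ψ b)

section Plane

variable {P B : Type*} {I : P → B → Prop} {q : ℕ}

theorem exists_isPlaneModel (h : IsSymDesign I (q ^ 2 + q + 1) (q + 1) 1) :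
    ∃ (φ : P → Fin (q + 1) ⊕ (Fin (q + 1) → Fin q)) (ψ : B → Option (Fin (q + 1) × Fin q)),
      IsPlaneModel I φ ψ := by
  classical
  have := h.finite_points (by omega)
  have := h.finite_blocks (by omega)
  obtain ⟨b₀⟩ : Nonempty B := by
    rw [← Finite.card_pos_iff, h.card_blocks]
    omega
  obtain ⟨e⟩ : Nonempty ({p // I p b₀} ≃ Fin (q + 1)) :=
    Finite.card_eq.1 (by rw [Nat.card_fin]; exact h.block_size b₀)
  -- the point of `b₀` on another block `b`
  have hpt : ∀ b, ∃ p, b ≠ b₀ → ∀ x, I x b ∧ I x b₀ ↔ x = p := by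
    intro b
    by_cases hb : b = b₀
    · exact ⟨(e.symm 0).1, fun h => (h hb).elim⟩
    · obtain ⟨p, hp⟩ := Set.ncard_eq_one.1 (h.blocks_common b b₀ hb)
      exact ⟨p, fun _ x => Set.ext_iff.1 hp x⟩
  choose pt hpt using hpt
  -- the block through the point `i` of `b₀` and another point `p`
  have hbl : ∀ p i, ∃ b, ¬ I p b₀ → ∀ x, I p x ∧ I (e.symm i) x ↔ x = b := by
    intro p i
    by_cases hp : I p b₀
    · exact ⟨b₀, fun h => (h hp).elim⟩
    · obtain ⟨b, hb⟩ := Set.ncard_eq_one.1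
        (h.points_common p (e.symm i) fun he => hp (he ▸ (e.symm i).2))
      exact ⟨b, fun _ x => Set.ext_iff.1 hb x⟩
  choose bl hbl using hbl
  have hlab : ∀ i, Nonempty ({b // b ≠ b₀ ∧ I (e.symm i) b} ≃ Fin q) := by
    intro i
    refine Finite.card_eq.1 ?_
    rw [Nat.card_fin]
    have h1 : {b | I (e.symm i) b} = insert b₀ {b | b ≠ b₀ ∧ I (e.symm i) b} := by
      ext b
      by_cases hb : b = b₀
      · simp [hb, (e.symm i).2]
      · simp [hb]
    have h2 := h.point_degree (e.symm i)
    rw [h1, Set.ncard_insert_of_notMem (by simp)] at h2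
    exact Nat.succ_injective h2
  let lab := fun i => (hlab i).some
  have hpti : ∀ b (hb : b ≠ b₀), I (pt b) b ∧ I (pt b) b₀ := fun b hb => (hpt b hb _).2 rfl
  have hbli : ∀ p (hp : ¬ I p b₀) i, I p (bl p i) ∧ I (e.symm i) (bl p i) :=
    fun p hp i => (hbl p i hp _).2 rfl
  have hbl0 : ∀ p (hp : ¬ I p b₀) i, bl p i ≠ b₀ := fun p hp i h' => hp (h' ▸ (hbli p hp i).1)
  let φ : P → Fin (q + 1) ⊕ (Fin (q + 1) → Fin q) := fun p =>
    if hp : I p b₀ then Sum.inl (e ⟨p, hp⟩)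
    else Sum.inr fun i => lab i ⟨bl p i, hbl0 p hp i, (hbli p hp i).2⟩
  let ψ : B → Option (Fin (q + 1) × Fin q) := fun b =>
    if hb : b = b₀ then none
    else some (e ⟨pt b, (hpti b hb).2⟩, lab (e ⟨pt b, (hpti b hb).2⟩)
      ⟨b, hb, by simpa using (hpti b hb).1⟩)
  refine ⟨φ, ψ, fun p b => ?_⟩
  by_cases hp : I p b₀ <;> by_cases hb : b = b₀
  · simp [φ, ψ, hp, hb, PlaneIncidence]
  · have := hpt b hb p
    simp only [φ, ψ, hp, hb, PlaneIncidence, dif_pos, dif_neg, not_false_eq_true,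
      e.injective.eq_iff, Subtype.mk.injEq]
    tauto
  · simp [φ, ψ, hp, hb, PlaneIncidence]
  · simp only [φ, ψ, hp, hb, PlaneIncidence, dif_neg, not_false_eq_true,
      (lab _).injective.eq_iff, Subtype.mk.injEq]
    rw [eq_comm, ← hbl p _ hp b, e.symm_apply_apply]
    exact ⟨fun h => ⟨h, (hpti b hb).1⟩, fun h => h.1⟩

namespace IsPlaneModel

variable {φ : P → Fin (q + 1) ⊕ (Fin (q + 1) → Fin q)} {ψ : B → Option (Fin (q + 1) × Fin q)}

/-- Renaming the points of the line `none` by `σ`, and the lines through each of them by `τ`. -/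
theorem relabel (hm : IsPlaneModel I φ ψ) (σ : Equiv.Perm (Fin (q + 1)))
    (τ : Fin (q + 1) → Equiv.Perm (Fin q)) :
    IsPlaneModel I (fun p => (φ p).map σ fun w j => τ j (w (σ.symm j)))
      (fun b => (ψ b).map fun x => (σ x.1, τ (σ x.1) x.2)) := by
  intro p b
  rw [hm p b]
  dsimp only
  rcases φ p with i | w <;> rcases ψ b with _ | ⟨j, c⟩ <;> simp [PlaneIncidence]

theorem bijective (hm : IsPlaneModel I φ ψ) (h : IsSymDesign I (q ^ 2 + q + 1) (q + 1) 1)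
    (hq : 0 < q) : Function.Bijective ψ := by
  have := h.finite_blocks (by omega)
  refine (h.injective_of_map (by omega) hm).2.bijective_of_nat_card_le ?_
  rw [h.card_blocks]
  simp
  ring_nf
  rfl

/-- Two points off the line `none` have exactly one letter in common. -/
theorem card_agree (hm : IsPlaneModel I φ ψ) (h : IsSymDesign I (q ^ 2 + q + 1) (q + 1) 1)
    (hq : 0 < q) {p p' : P} {w w' : Fin (q + 1) → Fin q} (hp : φ p = Sum.inr w)
    (hp' : φ p' = Sum.inr w') :
    w = w' ∨ (Finset.univ.filter fun j => w j = w' j).card = 1 := by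
  by_cases hpp' : p = p'
  · left
    rw [hpp', hp'] at hp
    exact (Sum.inr_injective hp).symm
  right
  obtain ⟨b, hb⟩ := Set.ncard_eq_one.1 (h.points_common p p' hpp')
  have hb' : ∀ x, (I p x ∧ I p' x) ↔ x = b := fun x => Set.ext_iff.1 hb x
  have hbij := hm.bijective h hq
  have key : ∀ j, w j = w' j ↔ ψ b = some (j, w j) := by
    intro j
    obtain ⟨x, hx⟩ := hbij.2 (some (j, w j))
    rw [← hx, hbij.1.eq_iff, eq_comm (a := b), ← hb', hm, hm, hp, hp', hx]
    simp [PlaneIncidence, eq_comm]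
  have h1 := (hb' b).2 rfl
  rw [hm, hm, hp, hp'] at h1
  rcases hψ : ψ b with _ | ⟨j, c⟩
  · rw [hψ] at h1
    exact h1.1.elim
  · rw [hψ] at h1
    obtain ⟨h1, -⟩ := h1
    rw [Finset.card_eq_one]
    refine ⟨j, ?_⟩
    ext i
    simp only [Finset.mem_filter, Finset.mem_univ, true_and, Finset.mem_singleton, key, hψ,
      Option.some.injEq, Prod.mk.injEq]
    constructor
    · exact fun h => h.1.symm
    · rintro rfl
      exact ⟨rfl, h1.symm⟩

/-- Lines through different points of the line `none` meet off that line. -/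
theorem exists_word (hm : IsPlaneModel I φ ψ) (h : IsSymDesign I (q ^ 2 + q + 1) (q + 1) 1)
    (hq : 0 < q) {i j : Fin (q + 1)} (hij : i ≠ j) (c d : Fin q) :
    ∃ p w, φ p = Sum.inr w ∧ w i = c ∧ w j = d := by
  have hbij := hm.bijective h hq
  obtain ⟨b, hb⟩ := hbij.2 (some (i, c))
  obtain ⟨b', hb'⟩ := hbij.2 (some (j, d))
  have hne : b ≠ b' := by
    rintro rfl
    rw [hb] at hb'
    simp only [Option.some.injEq, Prod.mk.injEq] at hb'
    exact hij hb'.1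
  obtain ⟨p, hp⟩ := Set.nonempty_of_ncard_ne_zero (s := {p | I p b ∧ I p b'})
    (by rw [h.blocks_common b b' hne]; exact one_ne_zero)
  have h1 : I p b ∧ I p b' := hp
  rw [hm, hm, hb, hb'] at h1
  rcases hφ : φ p with x | w
  · rw [hφ] at h1
    exact (hij (h1.1.symm.trans h1.2)).elim
  · rw [hφ] at h1
    exact ⟨p, w, hφ, h1⟩

end IsPlaneModel

end Plane

/-- A projective plane is unique if it can be coordinatised such that a fixed list `L` of words
occurs, and at most `q ^ 2` words are compatible with those in `L`. -/
theorem uniqueSymDesign_plane {q : ℕ} (hq : 0 < q) (L : List (Fin (q + 1) → Fin q))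
    (hL : Fintype.card {w : Fin (q + 1) → Fin q // ∀ c ∈ L, w = c ∨
      (Finset.univ.filter fun j => w j = c j).card = 1} ≤ q ^ 2)
    (h : ∀ ⦃P B : Type⦄ (I : P → B → Prop), IsSymDesign I (q ^ 2 + q + 1) (q + 1) 1 →
      ∃ (φ : P → Fin (q + 1) ⊕ (Fin (q + 1) → Fin q)) (ψ : B → Option (Fin (q + 1) × Fin q)),
      IsPlaneModel I φ ψ ∧ ∀ c ∈ L, ∃ p, φ p = Sum.inr c) :
    UniqueSymDesign (q ^ 2 + q + 1) (q + 1) 1 := by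
  refine uniqueSymDesign_of_map (by omega) (by omega)
    (S := Fin (q + 1) ⊕ {w : Fin (q + 1) → Fin q // ∀ c ∈ L, w = c ∨
      (Finset.univ.filter fun j => w j = c j).card = 1}) (T := Option (Fin (q + 1) × Fin q))
    (fun s t => PlaneIncidence (Sum.map id Subtype.val s) t) ?_ ?_ ?_
  · rw [Nat.card_eq_fintype_card, Fintype.card_sum, Fintype.card_fin]
    omega
  · simp
    ring_nf
    rfl
  · intro P B I hI
    obtain ⟨φ, ψ, hm, hφ⟩ := h I hI
    have hx : ∀ p, ∃ s : Fin (q + 1) ⊕ {w : Fin (q + 1) → Fin q // ∀ c ∈ L, w = c ∨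
      (Finset.univ.filter fun j => w j = c j).card = 1}, φ p = Sum.map id Subtype.val s := by
      intro p
      rcases hp : φ p with i | w
      · exact ⟨Sum.inl i, rfl⟩
      · refine ⟨Sum.inr ⟨w, fun c hc => ?_⟩, rfl⟩
        obtain ⟨p', hp'⟩ := hφ c hc
        exact hm.card_agree hI hq hp hp'
    choose φ' hφ' using hx
    exact ⟨φ', ψ, fun p b => by rw [hm p b, hφ']⟩

/-- The Fano plane is unique. -/
theorem uniqueSymDesign_seven : UniqueSymDesign 7 3 1 := by
  refine uniqueSymDesign_plane (q := 2) two_pos [fun _ => 0] (by decide +kernel) ?_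
  intro P B I hI
  obtain ⟨φ, ψ, hm⟩ := exists_isPlaneModel (q := 2) hI
  obtain ⟨p, w, hp, -⟩ := hm.exists_word hI two_pos (i := 0) (j := 1) (by decide) 0 0
  refine ⟨_, _, hm.relabel 1 (fun j => Equiv.swap (w j) 0), ?_⟩
  simp only [List.mem_singleton, forall_eq]
  refine ⟨p, ?_⟩
  rw [hp, Sum.map_inr]
  exact congrArg _ (funext fun j => Equiv.swap_apply_left (w j) 0)

/-- The projective plane of order three is unique: the words off a line can be normalised to the
ternary tetracode. -/
theorem uniqueSymDesign_thirteen : UniqueSymDesign 13 4 1 := by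
  refine uniqueSymDesign_plane (q := 3) three_pos
    [![0, 0, 0, 0], ![0, 1, 1, 1], ![0, 2, 2, 2], ![1, 0, 1, 2]] (by decide +kernel) ?_
  intro P B I hI
  -- the lines through the points `2` and `3` can be named such that the words `0, y, y, y` occur
  obtain ⟨φ, ψ, hm, hy⟩ : ∃ (φ : P → Fin 4 ⊕ (Fin 4 → Fin 3)) (ψ : B → Option (Fin 4 × Fin 3)),
      IsPlaneModel I φ ψ ∧ ∀ y, ∃ p, φ p = Sum.inr ![0, y, y, y] := by
    obtain ⟨φ, ψ, hm⟩ := exists_isPlaneModel (q := 3) hI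
    choose p w hp hw0 hw1 using hm.exists_word hI three_pos (i := 0) (j := 1) (by decide) 0
    have hinj : ∀ j, j ≠ 0 → Function.Injective fun y => w y j := by
      intro j hj y y' hyy'
      rcases hm.card_agree hI three_pos (hp y) (hp y') with h1 | h1
      · rw [← hw1 y, h1, hw1 y']
      · refine (hj (Finset.card_le_one.1 h1.le j ?_ 0 ?_)).elim
        · simpa using hyy'
        · simp [hw0]
    let π : ∀ j : Fin 4, j ≠ 0 → Equiv.Perm (Fin 3) := fun j hj =>
      Equiv.ofBijective _ (Finite.injective_iff_bijective.1 (hinj j hj))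
    refine ⟨_, _, hm.relabel 1 ![1, 1, (π 2 (by decide)).symm, (π 3 (by decide)).symm],
      fun y => ⟨p y, ?_⟩⟩
    rw [hp, Sum.map_inr]
    congr 1
    ext j : 1
    fin_cases j
    · exact hw0 y
    · exact hw1 y
    · exact (π 2 (by decide)).symm_apply_apply y
    · exact (π 3 (by decide)).symm_apply_apply y
  obtain ⟨p, w, hp, hw0, hw1⟩ := hm.exists_word hI three_pos (i := 0) (j := 1) (by decide) 1 0
  have hagree : ∀ y, w = ![0, y, y, y] ∨
      (Finset.univ.filter fun j => w j = ![0, y, y, y] j).card = 1 := by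
    intro y
    obtain ⟨p', hp'⟩ := hy y
    exact hm.card_agree hI three_pos hp hp'
  have hw : w = ![1, 0, 1, 2] ∨ w = ![1, 0, 2, 1] := by
    clear hp
    revert w
    decide +kernel
  rcases hw with rfl | rfl
  · refine ⟨φ, ψ, hm, ?_⟩
    simp only [List.mem_cons, List.not_mem_nil, or_false, forall_eq_or_imp, forall_eq]
    exact ⟨hy 0, hy 1, hy 2, p, hp⟩
  · refine ⟨_, _, hm.relabel (Equiv.swap 2 3) 1, ?_⟩
    obtain ⟨p0, h0⟩ := hy 0
    obtain ⟨p1, h1⟩ := hy 1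
    obtain ⟨p2, h2⟩ := hy 2
    simp only [List.mem_cons, List.not_mem_nil, or_false, forall_eq_or_imp, forall_eq]
    refine ⟨⟨p0, ?_⟩, ⟨p1, ?_⟩, ⟨p2, ?_⟩, ⟨p, ?_⟩⟩
    · rw [h0, Sum.map_inr]; congr 1; decide
    · rw [h1, Sum.map_inr]; congr 1; decide
    · rw [h2, Sum.map_inr]; congr 1; decide
    · rw [hp, Sum.map_inr]; congr 1; decide

/-! ### The biplane of order three -/

/-- The ten pairs of elements of `Fin 5`; the first five form a pentagon. -/
def pentagonEdge : Fin 10 → Finset (Fin 5) :=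
  ![{0, 1}, {1, 2}, {2, 3}, {3, 4}, {4, 0}, {0, 2}, {1, 3}, {2, 4}, {3, 0}, {4, 1}]

/-- The incidence structure in which a biplane with `5` points on each block is coordinatised by a
block `none` with points `inl i`. Every other block is named by the pair of points that it shares
with `none`; a point off `none` is the graph on `Fin 5` formed by the pairs that name its blocks,
encoded as a bit vector. -/
def BiplaneIncidence : Fin 5 ⊕ Fin 1024 → Option (Fin 10) → Prop
  | Sum.inl _, none => True
  | Sum.inl i, some t => i ∈ pentagonEdge t
  | Sum.inr _, none => False
  | Sum.inr x, some t => x.1.testBit t = true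

/-- The graph on `Fin 5` with edges the bits of `x` is a 2-regular graph, that is, a pentagon. -/
def IsPentagon (x : Fin 1024) : Prop :=
  ∀ i, (Finset.univ.filter fun t : Fin 10 =>
    x.1.testBit t = true ∧ i ∈ pentagonEdge t).card = 2

instance : DecidablePred IsPentagon := fun _ =>
  inferInstanceAs (Decidable (∀ _, _))

theorem pentagonEdge_surj : ∀ s : Finset (Fin 5), s.card = 2 → ∃ t, pentagonEdge t = s := by
  decide +kernel

theorem pentagonEdge_pair : ∀ t, ∃ i j, i ≠ j ∧ pentagonEdge t = {i, j} := by
  decide +kernel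

/-- Every 2-regular graph on five vertices is the pentagon formed by the first five pairs, up to the
renaming `![a, b, c, d, e]` of the vertices. -/
theorem exists_relabel_pentagon : ∀ x : Fin 1024, IsPentagon x →
    ∃ a b c d e : Fin 5, Function.Injective ![a, b, c, d, e] ∧ ∀ s t : Fin 10,
      (∀ i, ![a, b, c, d, e] i ∈ pentagonEdge s ↔ i ∈ pentagonEdge t) →
        (x.1.testBit s = true ↔ t < 5) := by
  decide +kernel

/-- Six pentagons on a set of five points form a biplane together with the pairs of points; they are
determined by one of them, since the others share exactly two edges with it. The bit vector `31` is
the pentagon formed by the first five pairs. -/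
theorem card_pentagons : Fintype.card {x : Fin 1024 // IsPentagon x ∧ (x = 31 ∨
    (Finset.univ.filter fun t : Fin 10 =>
      x.1.testBit t = true ∧ (31 : Fin 1024).1.testBit t = true).card = 2)} ≤ 6 := by
  decide +kernel

section Biplane

variable {P B : Type*} {I : P → B → Prop}

theorem exists_biplane_map (h : IsSymDesign I 11 5 2) {b₀ : B} (e : {p // I p b₀} ≃ Fin 5) :
    ∃ (φ : P → Fin 5 ⊕ Fin 1024) (ψ : B → Option (Fin 10)),
      (∀ p b, I p b ↔ BiplaneIncidence (φ p) (ψ b)) ∧ ψ b₀ = none ∧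
      (∀ i, φ (e.symm i) = Sum.inl i) ∧ ∀ p, ¬ I p b₀ → ∃ x, φ p = Sum.inr x := by
  classical
  have := h.finite_points (by omega)
  have := h.finite_blocks (by omega)
  -- the name of a block
  have hname : ∀ b, ∃ t, b ≠ b₀ → ∀ i, I (e.symm i) b ↔ i ∈ pentagonEdge t := by
    intro b
    by_cases hb : b = b₀
    · exact ⟨0, fun h => (h hb).elim⟩
    obtain ⟨t, ht⟩ := pentagonEdge_surj (Finset.univ.filter fun i => I (e.symm i) b) (by
      rw [← h.blocks_common b b₀ hb, ← Set.ncard_coe_finset,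
        ← Set.ncard_image_of_injective _ (Subtype.val_injective.comp e.symm.injective)]
      refine congrArg Set.ncard (Set.ext fun p => ⟨?_, ?_⟩)
      · rintro ⟨i, hi, rfl⟩
        exact ⟨by simpa using hi, (e.symm i).2⟩
      · rintro ⟨h1, h2⟩
        exact ⟨e ⟨p, h2⟩, by simpa using h1, by simp⟩)
    exact ⟨t, fun _ i => by simp [ht]⟩
  choose name hname using hname
  have hinj : ∀ b b', b ≠ b₀ → b' ≠ b₀ → name b = name b' → b = b' := by
    intro b b' hb hb' hbb'
    obtain ⟨i, j, hij, ht⟩ := pentagonEdge_pair (name b)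
    have h2 := h.points_common (e.symm i) (e.symm j)
      fun h => hij (e.symm.injective (Subtype.ext h))
    by_contra hne
    have h3 : ({b₀, b, b'} : Finset B).card = 3 := by
      rw [Finset.card_eq_three]
      exact ⟨b₀, b, b', hb.symm, hb'.symm, hne, rfl⟩
    have h4 : (({b₀, b, b'} : Finset B) : Set B) ⊆ {b | I (e.symm i) b ∧ I (e.symm j) b} := by
      intro x hx
      simp only [Finset.coe_insert, Finset.coe_singleton, Set.mem_insert_iff,
        Set.mem_singleton_iff] at hx
      rcases hx with rfl | rfl | rfl
      · exact ⟨(e.symm i).2, (e.symm j).2⟩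
      · exact ⟨(hname _ hb i).2 (by simp [ht]), (hname _ hb j).2 (by simp [ht])⟩
      · exact ⟨(hname _ hb' i).2 (by simp [← hbb', ht]), (hname _ hb' j).2 (by simp [← hbb', ht])⟩
    have h5 := Set.ncard_le_ncard h4 (Set.toFinite _)
    rw [h2, Set.ncard_coe_finset, h3] at h5
    omega
  -- the bit vector of a point
  let bits : P → Fin 10 → Bool := fun p t => decide (∃ b, b ≠ b₀ ∧ name b = t ∧ I p b)
  let φ : P → Fin 5 ⊕ Fin 1024 := fun p =>
    if hp : I p b₀ then Sum.inl (e ⟨p, hp⟩)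
    else Sum.inr ⟨Nat.ofBits (bits p), Nat.ofBits_lt_two_pow (bits p)⟩
  refine ⟨φ, fun b => if b = b₀ then none else some (name b), fun p b => ?_, if_pos rfl,
    fun i => ?_, fun p hp => ⟨_, dif_neg hp⟩⟩
  · by_cases hp : I p b₀ <;> by_cases hb : b = b₀
    · simp [φ, hp, hb, BiplaneIncidence]
    · simp only [φ, hp, hb, dif_pos, if_neg, BiplaneIncidence, not_false_eq_true]
      rw [← hname b hb, e.symm_apply_apply]
    · simp [φ, hp, hb, BiplaneIncidence]
    · simp only [φ, hp, hb, dif_neg, if_neg, BiplaneIncidence, not_false_eq_true]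
      rw [Nat.testBit_ofBits_lt _ _ (name b).2]
      simp only [bits, decide_eq_true_eq]
      constructor
      · exact fun h => ⟨b, hb, rfl, h⟩
      · rintro ⟨b', hb', h1, h2⟩
        rwa [← hinj b' b hb' hb h1]
  · simp [φ, (e.symm i).2]

theorem biplane_card_common (h : IsSymDesign I 11 5 2) {φ : P → Fin 5 ⊕ Fin 1024}
    {ψ : B → Option (Fin 10)} (hm : ∀ p b, I p b ↔ BiplaneIncidence (φ p) (ψ b)) {p p' : P}
    (hpp' : p ≠ p') {x : Fin 1024} (hx : φ p = Sum.inr x) (A : Fin 10 → Prop) [DecidablePred A]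
    (hA : ∀ t, BiplaneIncidence (φ p') (some t) ↔ A t) :
    (Finset.univ.filter fun t : Fin 10 => x.1.testBit t = true ∧ A t).card = 2 := by
  have := h.finite_blocks (by omega)
  have hψ : Function.Bijective ψ :=
    (h.injective_of_map (by omega) hm).2.bijective_of_nat_card_le (by rw [h.card_blocks]; simp)
  rw [← h.points_common p p' hpp', ← Set.ncard_image_of_injective _ hψ.1, ← Set.ncard_coe_finset,
    ← Set.ncard_image_of_injective _ (Option.some_injective _)]
  refine congrArg Set.ncard (Set.ext fun t => ⟨?_, ?_⟩)
  · rintro ⟨t, ht, rfl⟩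
    simp only [Finset.coe_filter, Finset.mem_univ, true_and, Set.mem_ofPred_eq] at ht
    obtain ⟨b, hb⟩ := hψ.2 (some t)
    refine ⟨b, ⟨?_, ?_⟩, hb⟩
    · rw [hm, hb, hx]
      exact ht.1
    · rw [hm, hb, hA]
      exact ht.2
  · rintro ⟨b, ⟨h1, h2⟩, rfl⟩
    rw [hm, hx] at h1
    rw [hm] at h2
    rcases hb : ψ b with _ | t
    · rw [hb] at h1
      exact h1.elim
    · rw [hb] at h1 h2
      exact ⟨t, by simpa using ⟨h1, (hA t).1 h2⟩, rfl⟩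

theorem isPentagon_of_map (h : IsSymDesign I 11 5 2) {φ : P → Fin 5 ⊕ Fin 1024}
    {ψ : B → Option (Fin 10)} (hm : ∀ p b, I p b ↔ BiplaneIncidence (φ p) (ψ b))
    (hφ : ∀ i, ∃ p, φ p = Sum.inl i) {p : P} {x : Fin 1024} (hx : φ p = Sum.inr x) :
    IsPentagon x := by
  intro i
  obtain ⟨p', hp'⟩ := hφ i
  refine biplane_card_common h hm (p' := p') ?_ hx (fun t => i ∈ pentagonEdge t) ?_
  · rintro rfl
    rw [hp'] at hx
    cases hx
  · intro t
    rw [hp']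
    exact Iff.rfl

end Biplane

/-- The biplane with block size five is unique. -/
theorem uniqueSymDesign_eleven : UniqueSymDesign 11 5 2 := by
  refine uniqueSymDesign_of_map (by omega) (by omega)
    (S := Fin 5 ⊕ {x : Fin 1024 // IsPentagon x ∧ (x = 31 ∨ (Finset.univ.filter fun t : Fin 10 =>
      x.1.testBit t = true ∧ (31 : Fin 1024).1.testBit t = true).card = 2)}) (T := Option (Fin 10))
    (fun s t => BiplaneIncidence (Sum.map id Subtype.val s) t) ?_ (by simp) ?_
  · have := card_pentagons
    rw [Nat.card_eq_fintype_card, Fintype.card_sum, Fintype.card_fin]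
    omega
  intro P B I hI
  have := hI.finite_points (by omega)
  have := hI.finite_blocks (by omega)
  obtain ⟨b₀⟩ : Nonempty B := by
    rw [← Finite.card_pos_iff, hI.card_blocks]
    omega
  obtain ⟨p₀, hp₀⟩ : ∃ p, ¬ I p b₀ := by
    by_contra! hall
    have h1 := hI.block_size b₀
    have h2 := hI.card_points
    rw [← Set.ncard_univ] at h2
    have h3 : {p | I p b₀} = Set.univ := Set.eq_univ_of_forall hall
    rw [h3] at h1
    omega
  obtain ⟨e⟩ : Nonempty ({p // I p b₀} ≃ Fin 5) :=
    Finite.card_eq.1 (by rw [Nat.card_fin]; exact hI.block_size b₀)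
  obtain ⟨e, φ, ψ, hm, hφ, hout, hφ₀⟩ : ∃ (e : {p // I p b₀} ≃ Fin 5) (φ : P → Fin 5 ⊕ Fin 1024)
      (ψ : B → Option (Fin 10)), (∀ p b, I p b ↔ BiplaneIncidence (φ p) (ψ b)) ∧
      (∀ i, φ (e.symm i) = Sum.inl i) ∧ (∀ p, ¬ I p b₀ → ∃ x, φ p = Sum.inr x) ∧
      φ p₀ = Sum.inr 31 := by
    obtain ⟨φ, ψ, hm, hb₀, hφ, hout⟩ := exists_biplane_map hI e
    obtain ⟨x, hx⟩ := hout p₀ hp₀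
    obtain ⟨v0, v1, v2, v3, v4, hv, hvx⟩ := exists_relabel_pentagon x
      (isPentagon_of_map hI hm (fun i => ⟨_, hφ i⟩) hx)
    generalize ![v0, v1, v2, v3, v4] = v at hv hvx
    let σ : Equiv.Perm (Fin 5) := Equiv.ofBijective v (Finite.injective_iff_bijective.1 hv)
    obtain ⟨φ', ψ', hm', hb₀', hφ', hout'⟩ := exists_biplane_map hI (e.trans σ.symm)
    refine ⟨_, φ', ψ', hm', hφ', hout', ?_⟩
    obtain ⟨x', hx'⟩ := hout' p₀ hp₀
    rw [hx']
    have hψ : Function.Bijective ψ :=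
      (hI.injective_of_map (by omega) hm).2.bijective_of_nat_card_le
        (by rw [hI.card_blocks]; simp)
    have hψ' : Function.Bijective ψ' :=
      (hI.injective_of_map (by omega) hm').2.bijective_of_nat_card_le
        (by rw [hI.card_blocks]; simp)
    have hbit : ∀ t : Fin 10, x'.1.testBit t = true ↔ t < 5 := by
      intro t
      obtain ⟨b, hb⟩ := hψ'.2 (some t)
      obtain ⟨s, hs⟩ : ∃ s, ψ b = some s := by
        rcases hs : ψ b with _ | s
        · rw [← hb₀] at hs
          rw [hψ.1 hs, hb₀'] at hb
          cases hb
        · exact ⟨s, rfl⟩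
      have h1 := hm p₀ b
      have h2 := hm' p₀ b
      rw [hx, hs] at h1
      rw [hx', hb] at h2
      refine (h2.symm.trans h1).trans (hvx s t fun i => ?_)
      have h3 := hm (e.symm (v i)) b
      have h4 := hm' ((e.trans σ.symm).symm i) b
      rw [hφ, hs] at h3
      rw [hφ', hb] at h4
      exact h3.symm.trans h4
    congr 1
    refine Fin.ext (Nat.eq_of_testBit_eq fun i => ?_)
    by_cases hi : i < 10
    · have h31 : ∀ t : Fin 10, (31 : Fin 1024).1.testBit t = true ↔ t < 5 := by decide
      exact Bool.eq_iff_iff.2 ((hbit ⟨i, hi⟩).trans (h31 ⟨i, hi⟩).symm)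
    · have hle : 2 ^ 10 ≤ 2 ^ i := Nat.pow_le_pow_right (by omega) (by omega)
      rw [Nat.testBit_lt_two_pow (lt_of_lt_of_le x'.2 hle),
        Nat.testBit_lt_two_pow (lt_of_lt_of_le (31 : Fin 1024).2 hle)]
  have hx : ∀ p, ∃ s : Fin 5 ⊕ {x : Fin 1024 // IsPentagon x ∧ (x = 31 ∨
      (Finset.univ.filter fun t : Fin 10 =>
      x.1.testBit t = true ∧ (31 : Fin 1024).1.testBit t = true).card = 2)},
      φ p = Sum.map id Subtype.val s := by
    intro p
    rcases hp : φ p with i | x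
    · exact ⟨Sum.inl i, rfl⟩
    · refine ⟨Sum.inr ⟨x, isPentagon_of_map hI hm (fun i => ⟨_, hφ i⟩) hp, ?_⟩, rfl⟩
      by_cases hpp : p = p₀
      · left
        rw [hpp, hφ₀] at hp
        exact (Sum.inr_injective hp).symm
      · right
        refine biplane_card_common hI hm hpp hp _ fun t => ?_
        rw [hφ₀]
        exact Iff.rfl
  choose φ' hφ' using hx
  exact ⟨φ', ψ, fun p b => by rw [hm p b, hφ']⟩

/-! ### The graphs of difference sets -/

section Gamma

variable {n : ℕ}

theorem compl_gammaGraph_adj_r_r (D : Finset (ZMod n)) (j a b : ZMod n) :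
    ¬ (gammaGraph n D j)ᶜ.Adj (.r a) (.r b) := by
  rw [SimpleGraph.compl_adj]
  rintro ⟨h1, h2⟩
  refine h2 (Or.inl ⟨b - a, fun h => h1 (by rw [sub_eq_zero.1 h]), ?_⟩)
  simp [DihedralGroup.inv_r, DihedralGroup.r_mul_r, sub_eq_add_neg]

theorem compl_gammaGraph_adj_sr_sr (D : Finset (ZMod n)) (j a b : ZMod n) :
    ¬ (gammaGraph n D j)ᶜ.Adj (.sr a) (.sr b) := by
  rw [SimpleGraph.compl_adj]
  rintro ⟨h1, h2⟩
  refine h2 (Or.inl ⟨a - b, fun h => h1 (by rw [sub_eq_zero.1 h]), ?_⟩)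
  simp [DihedralGroup.inv_sr]

theorem compl_gammaGraph_adj_r_sr (D : Finset (ZMod n)) (j a b : ZMod n) :
    (gammaGraph n D j)ᶜ.Adj (.r a) (.sr b) ↔ b - (a + j) ∉ D := by
  rw [SimpleGraph.compl_adj]
  have h1 : (gammaGraph n D j).Adj (.r a) (.sr b) ↔ b - (a + j) ∈ D := by
    simp only [gammaGraph, cayleyGraph, gammaSet, DihedralGroup.inv_r, DihedralGroup.sr_mul_r,
      Set.mem_union, Set.mem_ofPred_eq, reduceCtorEq, and_false, exists_false, false_or,
      DihedralGroup.sr.injEq]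
    constructor
    · rintro ⟨d, hd, h⟩
      have : b - (a + j) = d := by linear_combination h
      rwa [this]
    · exact fun h => ⟨_, h, by ring⟩
  rw [h1]
  simp

theorem compl_gammaGraph_adj_sr_r (D : Finset (ZMod n)) (j a b : ZMod n) :
    (gammaGraph n D j)ᶜ.Adj (.sr b) (.r a) ↔ (b - j) - a ∉ D := by
  rw [SimpleGraph.adj_comm, compl_gammaGraph_adj_r_sr, sub_sub, add_comm]

theorem ncard_setOf_r (A : DihedralGroup n → Prop) (hA : ∀ b, ¬ A (.sr b)) :
    {w | A w}.ncard = {a | A (.r a)}.ncard := by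
  rw [← Set.ncard_image_of_injective {a | A (.r a)} (f := DihedralGroup.r)
    fun _ _ => DihedralGroup.r.inj]
  refine congrArg Set.ncard (Set.ext ?_)
  rintro (a | b)
  · simp
  · simpa using hA b

theorem ncard_setOf_sr (A : DihedralGroup n → Prop) (hA : ∀ a, ¬ A (.r a)) :
    {w | A w}.ncard = {b | A (.sr b)}.ncard := by
  rw [← Set.ncard_image_of_injective {b | A (.sr b)} (f := DihedralGroup.sr)
    fun _ _ => DihedralGroup.sr.inj]
  refine congrArg Set.ncard (Set.ext ?_)
  rintro (a | b)
  · simpa using hA a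
  · simp

section Counting

variable (D : Finset (ZMod n))

theorem ncard_sub_left_mem (c : ZMod n) : {x | c - x ∈ D}.ncard = D.card := by
  rw [← Set.ncard_coe_finset, ← Set.ncard_image_of_injective {x | c - x ∈ D}
    (sub_right_injective (b := c))]
  exact congrArg Set.ncard (Set.image_preimage_eq (f := fun x => c - x) (D : Set (ZMod n))
    (fun y => ⟨c - y, by simp⟩))

theorem ncard_sub_right_mem (c : ZMod n) : {x | x - c ∈ D}.ncard = D.card := by
  rw [← Set.ncard_coe_finset, ← Set.ncard_image_of_injective {x | x - c ∈ D}
    (sub_left_injective (b := c))]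
  exact congrArg Set.ncard (Set.image_preimage_eq (f := fun x => x - c) (D : Set (ZMod n))
    (fun y => ⟨y + c, by simp⟩))

variable {D} {lam : ℕ}
  (hD : ∀ g : ZMod n, g ≠ 0 → ((D ×ˢ D).filter (fun p => -p.1 + p.2 = g)).card = lam)
include hD

theorem ncard_sub_left_mem_mem {c d : ZMod n} (hcd : c ≠ d) :
    {x | c - x ∈ D ∧ d - x ∈ D}.ncard = lam := by
  rw [← hD (d - c) (sub_ne_zero.2 hcd.symm), ← Set.ncard_coe_finset,
    ← Set.ncard_image_of_injective {x | c - x ∈ D ∧ d - x ∈ D} (f := fun x => (c - x, d - x))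
      fun x y h => sub_right_injective (congrArg Prod.fst h)]
  refine congrArg Set.ncard (Set.ext fun p => ?_)
  simp only [Set.mem_image, Set.mem_ofPred_eq, Finset.coe_filter, Finset.mem_product]
  constructor
  · rintro ⟨x, hx, rfl⟩
    exact ⟨hx, by ring⟩
  · rintro ⟨h1, h2⟩
    have h3 : d - (c - p.1) = p.2 := by linear_combination -h2
    refine ⟨c - p.1, ?_, ?_⟩
    · rwa [h3, sub_sub_cancel]
    · rw [h3, sub_sub_cancel]

theorem ncard_sub_right_mem_mem {c d : ZMod n} (hcd : c ≠ d) :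
    {x | x - c ∈ D ∧ x - d ∈ D}.ncard = lam := by
  rw [← hD (c - d) (sub_ne_zero.2 hcd), ← Set.ncard_coe_finset,
    ← Set.ncard_image_of_injective {x | x - c ∈ D ∧ x - d ∈ D} (f := fun x => (x - c, x - d))
      fun x y h => sub_left_injective (congrArg Prod.fst h)]
  refine congrArg Set.ncard (Set.ext fun p => ?_)
  simp only [Set.mem_image, Set.mem_ofPred_eq, Finset.coe_filter, Finset.mem_product]
  constructor
  · rintro ⟨x, hx, rfl⟩
    exact ⟨hx, by ring⟩
  · rintro ⟨h1, h2⟩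
    have h3 : p.1 + c - d = p.2 := by linear_combination -h2
    refine ⟨p.1 + c, ?_, ?_⟩
    · rwa [h3, add_sub_cancel_right]
    · rw [h3, add_sub_cancel_right]

/-- The standard count of the differences of a difference set. -/
theorem card_mul_card_differenceSet [NeZero n] : D.card * D.card = D.card + lam * (n - 1) := by
  have h1 := Finset.card_eq_sum_card_fiberwise (s := D ×ˢ D) (t := Finset.univ)
    (f := fun p => -p.1 + p.2) (by simp)
  rw [Finset.card_product, ← Finset.add_sum_erase _ _ (Finset.mem_univ (0 : ZMod n)),
    Finset.sum_congr rfl fun g hg => hD g (Finset.ne_of_mem_erase hg), Finset.sum_const,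
    Finset.card_erase_of_mem (Finset.mem_univ _), Finset.card_univ, ZMod.card, smul_eq_mul,
    mul_comm (n - 1)] at h1
  rw [h1]
  congr 1
  rw [← Finset.card_image_of_injective D (f := fun x => (x, x)) fun x y h => congrArg Prod.fst h]
  congr 1
  ext ⟨x, y⟩
  simp only [Finset.mem_filter, Finset.mem_product, neg_add_eq_zero, Finset.mem_image,
    Prod.mk.injEq]
  constructor
  · rintro ⟨⟨h, -⟩, rfl⟩
    exact ⟨x, h, rfl, rfl⟩
  · rintro ⟨z, h, rfl, rfl⟩
    exact ⟨⟨h, h⟩, rfl⟩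

end Counting

theorem ncard_compl_gammaGraph_adj [NeZero n] (D : Finset (ZMod n)) (j : ZMod n) {k : ℕ}
    (hk : D.card + k = n) (v : DihedralGroup n) :
    {w | (gammaGraph n D j)ᶜ.Adj v w}.ncard = k := by
  rcases v with a | b
  · rw [ncard_setOf_sr _ (compl_gammaGraph_adj_r_r D j a)]
    simp only [compl_gammaGraph_adj_r_sr]
    have := ncard_setOf_not fun x => x - (a + j) ∈ D
    rw [ncard_sub_right_mem, Nat.card_zmod] at this
    omega
  · rw [ncard_setOf_r _ (compl_gammaGraph_adj_sr_sr D j b)]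
    simp only [compl_gammaGraph_adj_sr_r]
    have := ncard_setOf_not fun x => (b - j) - x ∈ D
    rw [ncard_sub_left_mem, Nat.card_zmod] at this
    omega

/-- The complement of `Γ(D)` is the incidence graph of the development of the complement of `D`. -/
theorem isIncidenceUnion_compl_gammaGraph [NeZero n] {D : Finset (ZMod n)} {lam : ℕ}
    (hD : ∀ g : ZMod n, g ≠ 0 → ((D ×ˢ D).filter (fun p => -p.1 + p.2 = g)).card = lam)
    (j : ZMod n) {k l : ℕ} (hk : D.card + k = n) (hl : l + 2 * D.card = n + lam) (hl0 : 0 < l) :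
    IsIncidenceUnion (gammaGraph n D j)ᶜ n k l := by
  have hrr : ∀ a b, a ≠ b →
      {w | (gammaGraph n D j)ᶜ.Adj (.r a) w ∧ (gammaGraph n D j)ᶜ.Adj w (.r b)}.ncard = l := by
    intro a b hab
    rw [ncard_setOf_sr _ fun x h => compl_gammaGraph_adj_r_r D j a x h.1]
    simp only [compl_gammaGraph_adj_r_sr, SimpleGraph.adj_comm _ _ (DihedralGroup.r b)]
    have := ncard_setOf_not_and_not (fun x => x - (a + j) ∈ D) (fun x => x - (b + j) ∈ D)
    rw [ncard_sub_right_mem, ncard_sub_right_mem, Nat.card_zmod,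
      ncard_sub_right_mem_mem hD (by simpa using hab)] at this
    omega
  have hss : ∀ a b, a ≠ b →
      {w | (gammaGraph n D j)ᶜ.Adj (.sr a) w ∧ (gammaGraph n D j)ᶜ.Adj w (.sr b)}.ncard = l := by
    intro a b hab
    rw [ncard_setOf_r _ fun x h => compl_gammaGraph_adj_sr_sr D j a x h.1]
    simp only [compl_gammaGraph_adj_sr_r, SimpleGraph.adj_comm _ _ (DihedralGroup.sr b)]
    have := ncard_setOf_not_and_not (fun x => (a - j) - x ∈ D) (fun x => (b - j) - x ∈ D)
    rw [ncard_sub_left_mem, ncard_sub_left_mem, Nat.card_zmod,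
      ncard_sub_left_mem_mem hD (by simpa using hab)] at this
    omega
  have err : ∀ a b, EqOrMeet (gammaGraph n D j)ᶜ (.r a) (.r b) := by
    intro a b
    by_cases hab : a = b
    · exact Or.inl (by rw [hab])
    · exact Or.inr (Set.nonempty_of_ncard_ne_zero ((hrr a b hab).trans_ne hl0.ne'))
  have ess : ∀ a b, EqOrMeet (gammaGraph n D j)ᶜ (.sr a) (.sr b) := by
    intro a b
    by_cases hab : a = b
    · exact Or.inl (by rw [hab])
    · exact Or.inr (Set.nonempty_of_ncard_ne_zero ((hss a b hab).trans_ne hl0.ne'))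
  have ers : ∀ a b, ¬ EqOrMeet (gammaGraph n D j)ᶜ (.r a) (.sr b) := by
    rintro a b (h | ⟨c | c, h1, h2⟩)
    · cases h
    · exact compl_gammaGraph_adj_r_r _ _ _ _ h1
    · exact compl_gammaGraph_adj_sr_sr _ _ _ _ h2
  have esr : ∀ a b, ¬ EqOrMeet (gammaGraph n D j)ᶜ (.sr a) (.r b) := fun a b h =>
    ers b a h.symm
  refine ⟨ncard_compl_gammaGraph_adj D j hk, ?_, ?_, ?_, ?_⟩
  · rintro (a | a) (b | b) (c | c) <;>
      simp [-SimpleGraph.compl_adj, compl_gammaGraph_adj_r_r, compl_gammaGraph_adj_sr_sr]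
  · rintro (a | a) (b | b) (c | c) <;> simp [err, ess, ers, esr]
  · rintro (a | a)
    · rw [ncard_setOf_r _ (ers a)]
      simp [err, Set.ncard_univ]
    · rw [ncard_setOf_sr _ (esr a)]
      simp [ess, Set.ncard_univ]
  · rintro (a | a) (b | b) h hne
    · exact hrr a b fun h => hne (by rw [h])
    · exact (ers a b h).elim
    · exact (esr a b h).elim
    · exact hss a b fun h => hne (by rw [h])

/-- `K_m[Γ(D)]` has dimension two if the complementary design is unique. Here `D'` is a set of the
size of `D` that is not a difference set. -/
theorem wlDim_lexProduct_gammaGraph [NeZero n] {D : Finset (ZMod n)} {lam : ℕ}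
    (hD : ∀ g : ZMod n, g ≠ 0 → ((D ×ˢ D).filter (fun p => -p.1 + p.2 = g)).card = lam)
    (j : ZMod n) {k l : ℕ} (hU : UniqueSymDesign n k l) (hn : 1 < n) (hk0 : 0 < k)
    (hk : D.card + k = n) (hl : l + 2 * D.card = n + lam) (hl0 : 0 < l)
    (D' : Finset (ZMod n)) (hD' : D'.card = D.card) {c : ℕ}
    (hc : {x | x ∉ D' ∧ x - 1 ∉ D'}.ncard = c) (hc0 : c ≠ 0) (hcl : c ≠ l)
    {m : ℕ} (hm : 1 ≤ m) :
    wlDim (lexProductGraph (SimpleGraph.completeGraph (Fin m)) (gammaGraph n D j)) = 2 := by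
  have : Fact (1 < n) := ⟨hn⟩
  have hcard : {w | (gammaGraph n D' 0)ᶜ.Adj (.r 0) w ∧ (gammaGraph n D' 0)ᶜ.Adj w (.r 1)}.ncard
      = c := by
    rw [ncard_setOf_sr _ fun x h => compl_gammaGraph_adj_r_r D' 0 0 x h.1]
    simp only [compl_gammaGraph_adj_r_sr, SimpleGraph.adj_comm _ _ (DihedralGroup.r 1)]
    simpa using hc
  refine wlDim_lexProductGraph_eq_two (Y' := gammaGraph n D' 0) rfl hU hk0
    (isIncidenceUnion_compl_gammaGraph hD j hk hl hl0)
    (ncard_compl_gammaGraph_adj D' 0 (by rw [hD', hk])) (x := .r 0) (y := .r 1) ?_ ?_ ?_ hm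
  · exact fun h => zero_ne_one (DihedralGroup.r.inj h)
  · rwa [hcard]
  · rwa [hcard]

/-- For an initial segment `D'` of `ZMod n`, the number of common non-neighbours of the rotations by
`0` and `1` in `Γ(D')`. -/
theorem ncard_interval_shift :
    {x : ZMod 7 | x ∉ ({0, 1, 2} : Finset (ZMod 7)) ∧
      x - 1 ∉ ({0, 1, 2} : Finset (ZMod 7))}.ncard = 3 ∧
    {x : ZMod 7 | x ∉ ({0, 1, 2, 3} : Finset (ZMod 7)) ∧
      x - 1 ∉ ({0, 1, 2, 3} : Finset (ZMod 7))}.ncard = 2 ∧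
    {x : ZMod 11 | x ∉ ({0, 1, 2, 3, 4} : Finset (ZMod 11)) ∧
      x - 1 ∉ ({0, 1, 2, 3, 4} : Finset (ZMod 11))}.ncard = 5 ∧
    {x : ZMod 11 | x ∉ ({0, 1, 2, 3, 4, 5} : Finset (ZMod 11)) ∧
      x - 1 ∉ ({0, 1, 2, 3, 4, 5} : Finset (ZMod 11))}.ncard = 4 ∧
    {x : ZMod 13 | x ∉ ({0, 1, 2, 3} : Finset (ZMod 13)) ∧
      x - 1 ∉ ({0, 1, 2, 3} : Finset (ZMod 13))}.ncard = 8 ∧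
    {x : ZMod 13 | x ∉ ({0, 1, 2, 3, 4, 5, 6, 7, 8} : Finset (ZMod 13)) ∧
      x - 1 ∉ ({0, 1, 2, 3, 4, 5, 6, 7, 8} : Finset (ZMod 13))}.ncard = 3 := by
  simp only [Set.ncard_eq_toFinset_card']
  decide

theorem wlDim_lexProduct_gammaGraph_of_le_thirteen [NeZero n] (hn : n ≤ 13)
    {D : Finset (ZMod n)} (hD : IsDifferenceSet D) (hDn : D.card + 1 < n) (j : ZMod n)
    {m : ℕ} (hm : 1 ≤ m) :
    wlDim (lexProductGraph (SimpleGraph.completeGraph (Fin m)) (gammaGraph n D j)) = 2 := by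
  obtain ⟨lam, hlam, hD⟩ := hD
  have hcount := card_mul_card_differenceSet hD
  -- the parameters of the nontrivial symmetric designs with at most thirteen points
  have hpar : (n = 7 ∧ D.card = 3 ∧ lam = 1) ∨ (n = 7 ∧ D.card = 4 ∧ lam = 2) ∨
      (n = 11 ∧ D.card = 5 ∧ lam = 2) ∨ (n = 11 ∧ D.card = 6 ∧ lam = 3) ∨
      (n = 13 ∧ D.card = 4 ∧ lam = 1) ∨ (n = 13 ∧ D.card = 9 ∧ lam = 6) := by
    generalize D.card = d at hcount hDn
    have hd : d ≤ 11 := by omega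
    clear hD
    interval_cases n <;> interval_cases d <;> omega
  obtain ⟨h1, h2, h3, h4, h5, h6⟩ := ncard_interval_shift
  rcases hpar with ⟨rfl, hd, rfl⟩ | ⟨rfl, hd, rfl⟩ | ⟨rfl, hd, rfl⟩ | ⟨rfl, hd, rfl⟩ |
    ⟨rfl, hd, rfl⟩ | ⟨rfl, hd, rfl⟩
  · exact wlDim_lexProduct_gammaGraph (k := 4) (l := 2) hD j
      (uniqueSymDesign_seven.compl (by omega) (by omega) (by omega)) (by omega) (by omega)
      (by omega) (by omega) (by omega) {0, 1, 2} (by rw [hd]; decide) (c := 3)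
      h1
      (by omega) (by omega) hm
  · exact wlDim_lexProduct_gammaGraph (k := 3) (l := 1) hD j uniqueSymDesign_seven
      (by omega) (by omega) (by omega) (by omega) (by omega)
      {0, 1, 2, 3} (by rw [hd]; decide) (c := 2)
      h2 (by omega) (by omega) hm
  · exact wlDim_lexProduct_gammaGraph (k := 6) (l := 3) hD j
      (uniqueSymDesign_eleven.compl (by omega) (by omega) (by omega)) (by omega) (by omega)
      (by omega) (by omega) (by omega) {0, 1, 2, 3, 4} (by rw [hd]; decide) (c := 5)
      h3
      (by omega) (by omega) hm
  · exact wlDim_lexProduct_gammaGraph (k := 5) (l := 2) hD j uniqueSymDesign_eleven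
      (by omega) (by omega) (by omega) (by omega) (by omega)
      {0, 1, 2, 3, 4, 5} (by rw [hd]; decide) (c := 4)
      h4 (by omega) (by omega) hm
  · exact wlDim_lexProduct_gammaGraph (k := 9) (l := 6) hD j
      (uniqueSymDesign_thirteen.compl (by omega) (by omega) (by omega)) (by omega) (by omega)
      (by omega) (by omega) (by omega) {0, 1, 2, 3} (by rw [hd]; decide) (c := 8)
      h5
      (by omega) (by omega) hm
  · exact wlDim_lexProduct_gammaGraph (k := 4) (l := 1) hD j uniqueSymDesign_thirteen
      (by omega) (by omega) (by omega) (by omega) (by omega)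
      {0, 1, 2, 3, 4, 5, 6, 7, 8} (by rw [hd]; decide) (c := 3)
      h6 (by omega) (by omega) hm

end Gamma

/-! ### The graph `K_4 × K_2` -/

theorem compl_boxProd_adj (p q : Fin 4 × Fin 2) :
    (SimpleGraph.boxProd (SimpleGraph.completeGraph (Fin 4))
      (SimpleGraph.completeGraph (Fin 2)))ᶜ.Adj p q ↔ p.1 ≠ q.1 ∧ p.2 ≠ q.2 := by
  simp only [SimpleGraph.compl_adj, SimpleGraph.boxProd_adj, SimpleGraph.completeGraph,
    SimpleGraph.top_adj, ne_eq, Prod.ext_iff]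
  tauto

theorem eqOrMeet_compl_boxProd (p q : Fin 4 × Fin 2) :
    EqOrMeet (SimpleGraph.boxProd (SimpleGraph.completeGraph (Fin 4))
      (SimpleGraph.completeGraph (Fin 2)))ᶜ p q ↔ p.2 = q.2 := by
  simp only [EqOrMeet, compl_boxProd_adj]
  revert p q
  decide

/-- The complement of `K_4 × K_2` is the cube, the incidence graph of the design of the four
3-subsets of a 4-set. -/
theorem isIncidenceUnion_compl_boxProd :
    IsIncidenceUnion (SimpleGraph.boxProd (SimpleGraph.completeGraph (Fin 4))
      (SimpleGraph.completeGraph (Fin 2)))ᶜ 4 3 2 where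
  degree := by
    simp only [compl_boxProd_adj, Set.ncard_eq_toFinset_card']
    decide
  no_triangle := by
    simp only [compl_boxProd_adj]
    decide
  trans u w v := by
    simp only [eqOrMeet_compl_boxProd]
    exact Eq.trans
  class_card := by
    simp only [eqOrMeet_compl_boxProd, Set.ncard_eq_toFinset_card']
    decide
  common := by
    simp only [eqOrMeet_compl_boxProd, compl_boxProd_adj, Set.ncard_eq_toFinset_card']
    decide

theorem wlDim_lexProduct_boxProd {m : ℕ} (hm : 1 ≤ m) :
    wlDim (lexProductGraph (SimpleGraph.completeGraph (Fin m))
      (SimpleGraph.boxProd (SimpleGraph.completeGraph (Fin 4))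
        (SimpleGraph.completeGraph (Fin 2)))) = 2 := by
  -- the Möbius ladder has the order and the degree of the cube
  have hadj : ∀ p q : ZMod 8, (SimpleGraph.circulantGraph {1, 4})ᶜᶜ.Adj p q ↔
      p - q = 1 ∨ p - q = 4 ∨ p - q = -1 := by
    intro p q
    rw [compl_compl, SimpleGraph.circulantGraph_adj]
    simp only [Set.mem_insert_iff, Set.mem_singleton_iff]
    revert p q
    decide
  have hcard : {w | (SimpleGraph.circulantGraph {1, 4})ᶜᶜ.Adj (0 : ZMod 8) w ∧
      (SimpleGraph.circulantGraph {1, 4})ᶜᶜ.Adj w 2}.ncard = 1 := by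
    simp only [hadj, Set.ncard_eq_toFinset_card']
    decide
  refine wlDim_lexProductGraph_eq_two (Y' := (SimpleGraph.circulantGraph {1, 4})ᶜ) (by simp)
    ((uniqueSymDesign_one_zero (n := 4) (by omega)).compl (by omega) (by omega) (by omega))
    (by omega) isIncidenceUnion_compl_boxProd ?_ (x := (0 : ZMod 8)) (y := 2) (by decide)
    (by rw [hcard]; omega) (by rw [hcard]; omega) hm
  simp only [hadj, Set.ncard_eq_toFinset_card']
  decide

/-! ### Twisted cycles: definable relations -/

/-- The pairs of vertices of `ZMod M × Bool` at distance `± d` along the cycle `ZMod M`. -/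
def CycleDist {M : ℕ} (d : ZMod M) (p q : ZMod M × Bool) : Prop :=
  q.1 - p.1 = d ∨ q.1 - p.1 = -d

/-- The pairs of vertices of `ZMod M × Bool` in the same class, where the classes are given by the
colour `β` and the Boolean coordinate. -/
def SameClass {M : ℕ} (β : ZMod M → Bool) (p q : ZMod M × Bool) : Prop :=
  β p.1 = β q.1 ∧ p.2 = q.2

/-- The pairs of vertices in two different classes of the same colour. -/
def OppositeClass {M : ℕ} (β : ZMod M → Bool) (p q : ZMod M × Bool) : Prop :=
  β p.1 = β q.1 ∧ p.2 ≠ q.2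

/-- The data of a twisted cycle: the lexicographic product of a cycle of length `M` with two
isolated vertices, switched between opposite classes. The colouring `β` changes every second step;
`N` is the number of vertices of a class, and `5 ≤ N` separates the numbers `N + 2`, `N - 2` and `2`
of common neighbours. -/
structure IsTwistedCycle {M : ℕ} [NeZero M] (G : SimpleGraph (ZMod M × Bool)) (β : ZMod M → Bool)
    (N : ℕ) : Prop where
  adj_iff : ∀ p q, G.Adj p q ↔ Xor (CycleDist 1 p q) (OppositeClass β p q)
  color_add_two : ∀ t, β (t + 2) = !β t
  color_zero : β 0 = false
  color_one : β 1 = false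
  two_ne_zero : (2 : ZMod M) ≠ 0
  four_ne_zero : (4 : ZMod M) ≠ 0
  card_color : ∀ b, (Finset.univ.filter fun t => β t = b).card = N
  five_le : 5 ≤ N

open Classical in
/-- The number of common neighbours, as the entry of the square of the adjacency matrix. -/
noncomputable def commonCount {V : Type*} [Fintype V] (G : SimpleGraph V) (u v : V) : ℤ :=
  ∑ w, (if G.Adj u w then 1 else 0) * (if G.Adj w v then 1 else 0)

theorem commonCount_eq_ncard {V : Type*} [Fintype V] (G : SimpleGraph V) (u v : V) :
    commonCount G u v = {w | G.Adj u w ∧ G.Adj w v}.ncard := by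
  classical
  have hmul : ∀ w, (if G.Adj u w then 1 else 0 : ℤ) * (if G.Adj w v then 1 else 0) =
      if G.Adj u w ∧ G.Adj w v then 1 else 0 := by
    intro w
    rw [ite_and, ite_mul, one_mul, zero_mul]
  simp only [commonCount, hmul]
  rw [Finset.sum_boole, ← Set.ncard_coe_finset]
  simp

/-- The indicator of `OppositeClass` in terms of colours and Boolean coordinates. -/
def oppInd (b e b' e' : Bool) : ℤ := if b = b' ∧ e ≠ e' then 1 else 0

namespace IsTwistedCycle

variable {M : ℕ} [NeZero M] {G : SimpleGraph (ZMod M × Bool)} {β : ZMod M → Bool} {N : ℕ}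

theorem color_sub_one (h : IsTwistedCycle G β N) (t : ZMod M) : β (t - 1) = !β (t + 1) := by
  have := h.color_add_two (t - 1)
  rw [show t - 1 + 2 = t + 1 by ring] at this
  rw [this, Bool.not_not]

theorem sum_cycleDist_one (h : IsTwistedCycle G β N) (p : ZMod M × Bool)
    (f : ZMod M × Bool → ℤ) :
    ∑ w, (if w.1 = p.1 + 1 ∨ w.1 = p.1 - 1 then 1 else 0) * f w =
      f (p.1 + 1, false) + f (p.1 + 1, true) + f (p.1 - 1, false) + f (p.1 - 1, true) := by
  have hne : p.1 + 1 ≠ p.1 - 1 := fun e => h.two_ne_zero (by linear_combination e)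
  have hfilter : (Finset.univ.filter fun t : ZMod M => t = p.1 + 1 ∨ t = p.1 - 1) =
      {p.1 + 1, p.1 - 1} := by
    ext t
    simp
  rw [Fintype.sum_prod_type]
  simp only [ite_mul, one_mul, zero_mul, Fintype.sum_bool]
  have : ∀ t : ZMod M, ((if t = p.1 + 1 ∨ t = p.1 - 1 then f (t, true) else 0) +
      if t = p.1 + 1 ∨ t = p.1 - 1 then f (t, false) else 0) =
      if t = p.1 + 1 ∨ t = p.1 - 1 then f (t, true) + f (t, false) else 0 := by
    intro t
    split_ifs <;> simp
  simp only [this]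
  rw [← Finset.sum_filter, hfilter, Finset.sum_pair hne]
  ring

theorem sum_color (h : IsTwistedCycle G β N) (f : Bool → Bool → ℤ) :
    ∑ w : ZMod M × Bool, f (β w.1) w.2 =
      N * (f false false + f false true + f true false + f true true) := by
  rw [Fintype.sum_prod_type, ← Finset.sum_fiberwise (g := β)]
  have : ∀ b, ∑ t ∈ Finset.univ.filter (fun t => β t = b), ∑ e, f (β t) e =
      N * (f b true + f b false) := by
    intro b
    rw [Finset.sum_congr rfl (g := fun _ => f b true + f b false), Finset.sum_const,
      h.card_color, nsmul_eq_mul]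
    intro t ht
    rw [(Finset.mem_filter.1 ht).2, Fintype.sum_bool]
  rw [Finset.sum_congr rfl fun b _ => this b, Fintype.sum_bool]
  ring

open Classical in
/-- The adjacency matrix is the matrix of `OppositeClass`, corrected along the cycle. -/
theorem adj_ind (h : IsTwistedCycle G β N) (p q : ZMod M × Bool) :
    (if G.Adj p q then 1 else 0 : ℤ) = oppInd (β p.1) p.2 (β q.1) q.2 +
      (if q.1 = p.1 + 1 ∨ q.1 = p.1 - 1 then 1 else 0) *
        (1 - 2 * oppInd (β p.1) p.2 (β q.1) q.2) := by
  have h1 : CycleDist 1 p q ↔ (q.1 = p.1 + 1 ∨ q.1 = p.1 - 1) := by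
    rw [CycleDist, sub_eq_iff_eq_add', sub_eq_iff_eq_add', ← sub_eq_add_neg]
  have h2 : G.Adj p q ↔ Xor (q.1 = p.1 + 1 ∨ q.1 = p.1 - 1)
      (β p.1 = β q.1 ∧ p.2 ≠ q.2) := by
    rw [h.adj_iff, h1]
    rfl
  simp only [h2, oppInd]
  by_cases hc : q.1 = p.1 + 1 ∨ q.1 = p.1 - 1 <;> by_cases ho : β p.1 = β q.1 ∧ p.2 ≠ q.2 <;>
    simp [hc, ho, Xor]

/-- The part of the number of common neighbours that comes from two steps along the cycle. -/
theorem sum_cycle_cycle (h : IsTwistedCycle G β N) (p q : ZMod M × Bool) :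
    ∑ w : ZMod M × Bool, (if w.1 = p.1 + 1 ∨ w.1 = p.1 - 1 then 1 else 0) *
      ((if w.1 = q.1 + 1 ∨ w.1 = q.1 - 1 then 1 else 0) *
        ((1 - 2 * oppInd (β p.1) p.2 (β w.1) w.2) * (1 - 2 * oppInd (β w.1) w.2 (β q.1) q.2))) =
      if p = q then 4 else 0 := by
  rw [h.sum_cycleDist_one]
  simp only [h.color_sub_one]
  generalize β (p.1 + 1) = x
  obtain ⟨t, e⟩ := p
  obtain ⟨s, e'⟩ := q
  simp only [Prod.mk.injEq]
  have h2 := h.two_ne_zero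
  have h4 := h.four_ne_zero
  by_cases h0 : t = s
  · subst h0
    have e1 : t + 1 ≠ t - 1 := fun e => h2 (by linear_combination e)
    simp only [e1, e1.symm, true_or, or_true, if_true, one_mul, true_and]
    generalize β t = b
    revert x e e' b
    decide
  by_cases hp : s = t + 2
  · subst hp
    have e1 : t + 2 - 1 = t + 1 := by ring
    have e2 : t - 1 ≠ t + 2 + 1 := fun e => h4 (by linear_combination -e)
    have e3 : t - 1 ≠ t + 1 := fun e => h2 (by linear_combination -e)
    simp only [e1, e2, e3, or_true, or_self, if_true, if_false, one_mul, zero_mul, h0,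
      false_and, h.color_add_two]
    generalize β t = b
    revert x e e' b
    decide
  by_cases hm : t = s + 2
  · subst hm
    have e1 : s + 2 - 1 = s + 1 := by ring
    have e2 : s + 2 + 1 ≠ s + 1 := fun e => h2 (by linear_combination e)
    have e3 : s + 2 + 1 ≠ s - 1 := fun e => h4 (by linear_combination e)
    simp only [e1, e2, e3, true_or, or_self, if_true, if_false, one_mul, zero_mul, h0,
      false_and, h.color_add_two]
    generalize β s = b
    revert x e e' b
    decide
  · have e1 : t + 1 ≠ s + 1 := fun e => h0 (by linear_combination e)
    have e2 : t + 1 ≠ s - 1 := fun e => hp (by linear_combination -e)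
    have e3 : t - 1 ≠ s + 1 := fun e => hm (by linear_combination e)
    have e4 : t - 1 ≠ s - 1 := fun e => h0 (by linear_combination e)
    simp [e1, e2, e3, e4, h0]

/-- Twisted cycles are divisible design graphs: the number of common neighbours of two vertices
tells whether they are in the same class. -/
theorem commonCount_eq (h : IsTwistedCycle G β N) (p q : ZMod M × Bool) :
    commonCount G p q = if p = q then (N + 2 : ℤ) else
      if β p.1 = β q.1 ∧ p.2 = q.2 then (N - 2 : ℤ) else 2 := by
  have hsplit : ∀ w : ZMod M × Bool,
      (oppInd (β p.1) p.2 (β w.1) w.2 + (if w.1 = p.1 + 1 ∨ w.1 = p.1 - 1 then 1 else 0) *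
        (1 - 2 * oppInd (β p.1) p.2 (β w.1) w.2)) *
      (oppInd (β w.1) w.2 (β q.1) q.2 + (if w.1 = q.1 + 1 ∨ w.1 = q.1 - 1 then 1 else 0) *
        (1 - 2 * oppInd (β w.1) w.2 (β q.1) q.2)) =
      oppInd (β p.1) p.2 (β w.1) w.2 * oppInd (β w.1) w.2 (β q.1) q.2 +
      (if w.1 = p.1 + 1 ∨ w.1 = p.1 - 1 then 1 else 0) *
        ((1 - 2 * oppInd (β p.1) p.2 (β w.1) w.2) * oppInd (β w.1) w.2 (β q.1) q.2) +
      (if w.1 = q.1 + 1 ∨ w.1 = q.1 - 1 then 1 else 0) *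
        ((1 - 2 * oppInd (β w.1) w.2 (β q.1) q.2) * oppInd (β p.1) p.2 (β w.1) w.2) +
      (if w.1 = p.1 + 1 ∨ w.1 = p.1 - 1 then 1 else 0) *
        ((if w.1 = q.1 + 1 ∨ w.1 = q.1 - 1 then 1 else 0) *
        ((1 - 2 * oppInd (β p.1) p.2 (β w.1) w.2) *
          (1 - 2 * oppInd (β w.1) w.2 (β q.1) q.2))) := by
    intro w
    ring
  have hsymm : ∀ w : ZMod M × Bool, (q.1 = w.1 + 1 ∨ q.1 = w.1 - 1) ↔
      (w.1 = q.1 + 1 ∨ w.1 = q.1 - 1) := by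
    intro w
    rw [or_comm]
    exact or_congr ⟨fun e => by linear_combination -e, fun e => by linear_combination -e⟩
      ⟨fun e => by linear_combination -e, fun e => by linear_combination -e⟩
  rw [commonCount]
  simp only [h.adj_ind, hsymm, hsplit, Finset.sum_add_distrib]
  rw [h.sum_cycle_cycle, h.sum_cycleDist_one, h.sum_cycleDist_one,
    h.sum_color fun b e => oppInd (β p.1) p.2 b e * oppInd b e (β q.1) q.2]
  simp only [h.color_sub_one]
  have key : ∀ b e b' e' x y : Bool,
      oppInd b e false false * oppInd false false b' e' +
      oppInd b e false true * oppInd false true b' e' +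
      oppInd b e true false * oppInd true false b' e' +
      oppInd b e true true * oppInd true true b' e' = (if b = b' ∧ e = e' then 1 else 0) ∧
      (1 - 2 * oppInd b e x false) * oppInd x false b' e' +
      (1 - 2 * oppInd b e x true) * oppInd x true b' e' +
      (1 - 2 * oppInd b e (!x) false) * oppInd (!x) false b' e' +
      (1 - 2 * oppInd b e (!x) true) * oppInd (!x) true b' e' +
      ((1 - 2 * oppInd y false b' e') * oppInd b e y false +
      (1 - 2 * oppInd y true b' e') * oppInd b e y true +
      (1 - 2 * oppInd (!y) false b' e') * oppInd b e (!y) false +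
      (1 - 2 * oppInd (!y) true b' e') * oppInd b e (!y) true) =
        (if b = b' ∧ e = e' then -2 else 2) := by
    decide
  obtain ⟨k1, k2⟩ := key (β p.1) p.2 (β q.1) q.2 (β (p.1 + 1)) (β (q.1 + 1))
  rw [k1, add_assoc (_ * _), k2]
  by_cases hpq : p = q
  · subst hpq
    simp
    ring
  · simp only [hpq, if_false]
    split_ifs <;> ring

open Classical in
/-- The number of neighbours of a vertex in the class of another one. -/
theorem sum_adj_sameClass (h : IsTwistedCycle G β N) (p q : ZMod M × Bool) :
    ∑ w, (if G.Adj p w then 1 else 0 : ℤ) * (if SameClass β w q then 1 else 0) =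
      if β p.1 = β q.1 ∧ p.2 ≠ q.2 then (N - 1 : ℤ) else 1 := by
  have hclass : ∀ w, (if SameClass β w q then 1 else 0 : ℤ) =
      if β w.1 = β q.1 ∧ w.2 = q.2 then 1 else 0 := fun w => if_congr Iff.rfl rfl rfl
  simp only [hclass, h.adj_ind, add_mul, Finset.sum_add_distrib, mul_assoc]
  rw [h.sum_cycleDist_one,
    h.sum_color fun b e => oppInd (β p.1) p.2 b e * if b = β q.1 ∧ e = q.2 then 1 else 0]
  simp only [h.color_sub_one]
  have key : ∀ b e b' e' x : Bool,
      oppInd b e false false * (if false = b' ∧ false = e' then 1 else 0) +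
      oppInd b e false true * (if false = b' ∧ true = e' then 1 else 0) +
      oppInd b e true false * (if true = b' ∧ false = e' then 1 else 0) +
      oppInd b e true true * (if true = b' ∧ true = e' then 1 else 0) =
        (if b = b' ∧ e ≠ e' then 1 else 0) ∧
      (1 - 2 * oppInd b e x false) * (if x = b' ∧ false = e' then 1 else 0) +
      (1 - 2 * oppInd b e x true) * (if x = b' ∧ true = e' then 1 else 0) +
      (1 - 2 * oppInd b e (!x) false) * (if (!x) = b' ∧ false = e' then 1 else 0) +
      (1 - 2 * oppInd b e (!x) true) * (if (!x) = b' ∧ true = e' then 1 else 0) =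
        (if b = b' ∧ e ≠ e' then -1 else 1) := by
    decide
  obtain ⟨k1, k2⟩ := key (β p.1) p.2 (β q.1) q.2 (β (p.1 + 1))
  rw [k1, k2]
  split_ifs <;> ring

theorem ncard_adj (h : IsTwistedCycle G β N) (p : ZMod M × Bool) :
    {w | G.Adj p w}.ncard = N + 2 := by
  have h1 := commonCount_eq_ncard G p p
  rw [h.commonCount_eq, if_pos rfl] at h1
  simp only [G.adj_comm _ p, and_self] at h1
  exact_mod_cast h1.symm

end IsTwistedCycle

/-! ### Twisted cycles: reconstruction -/

/-- Axioms for relations `S d` ("at distance `± d` along a cycle of length `M`"), `E` ("in the same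
class") and `O` ("in opposite classes") on a set, in the form of statements that are preserved by
bisimulations. -/
structure IsTwistedSystem {M : ℕ} {W : Type*} (S : ZMod M → W → W → Prop) (E O : W → W → Prop) :
    Prop where
  dist_symm : ∀ d u v, S d u v → S d v u
  dist_neg : ∀ d u v, S d u v → S (-d) u v
  dist_refl : ∀ u v, u = v → S 0 u v
  dist_zero : ∀ d u w v, S d u w → S 0 w v → S d u v
  dist_step : ∀ d u w v, S d u w → S 1 w v → S (d + 1) u v ∨ S (d - 1) u v
  dist_unique : ∀ d d' u v, S d u v → S d' u v → d = d' ∨ d = -d'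
  card_dist_zero : ∀ u, {w | S 0 u w}.ncard = 2
  card_pred : ∀ d, d + d ≠ 0 → ∀ u v, S d u v → {w | S (d - 1) u w ∧ S 1 w v}.ncard = 2
  exists_next : ∀ u v, S 1 u v → ∃ w, S 2 u w ∧ S 1 w v
  same_symm : ∀ u v, E u v → E v u
  opp_symm : ∀ u v, O u v → O v u
  same_refl : ∀ u v, u = v → E u v
  not_opp_of_same : ∀ u v, E u v → ¬ O u v
  same_same : ∀ u w v, E u w → E w v → E u v
  same_opp : ∀ u w v, E u w → O w v → O u v
  opp_opp : ∀ u w v, O u w → O w v → E u v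
  exists_twin : ∀ u v, u = v → ∃ w, S 0 u w ∧ O w v
  color_two : ∀ u v, S 2 u v → ¬ (E u v ∨ O u v)
  color_trans : ∀ u w v, ¬ (E u w ∨ O u w) → ¬ (E w v ∨ O w v) → (E u v ∨ O u v)

namespace IsTwistedCycle

variable {M : ℕ} [NeZero M] {G : SimpleGraph (ZMod M × Bool)} {β : ZMod M → Bool} {N : ℕ}

omit [NeZero M] in
theorem setOf_cycleDist_zero (u : ZMod M × Bool) :
    {w | CycleDist 0 u w} = {(u.1, false), (u.1, true)} := by
  ext ⟨t, e⟩
  cases e <;> simp [CycleDist, sub_eq_zero]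

theorem setOf_cycleDist_pred (h : IsTwistedCycle G β N) {d : ZMod M} (hd : d + d ≠ 0)
    {u v : ZMod M × Bool} (huv : CycleDist d u v) :
    ∃ t, {w | CycleDist (d - 1) u w ∧ CycleDist 1 w v} = {(t, false), (t, true)} := by
  have h2 := h.two_ne_zero
  rcases huv with huv | huv
  · refine ⟨v.1 - 1, ?_⟩
    ext ⟨t, e⟩
    have : (CycleDist (d - 1) u (t, e) ∧ CycleDist 1 (t, e) v) ↔ t = v.1 - 1 := by
      simp only [CycleDist]
      constructor
      · rintro ⟨h1 | h1, h3 | h3⟩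
        · linear_combination -h3
        · exact (h2 (by linear_combination h1 + h3 - huv)).elim
        · linear_combination -h3
        · exact (hd (by linear_combination -huv + h1 + h3)).elim
      · rintro rfl
        exact ⟨Or.inl (by linear_combination huv), Or.inl (by ring)⟩
    rw [Set.mem_ofPred_eq, this]
    cases e <;> simp
  · refine ⟨v.1 + 1, ?_⟩
    ext ⟨t, e⟩
    have : (CycleDist (d - 1) u (t, e) ∧ CycleDist 1 (t, e) v) ↔ t = v.1 + 1 := by
      simp only [CycleDist]
      constructor
      · rintro ⟨h1 | h1, h3 | h3⟩
        · exact (hd (by linear_combination huv - h1 - h3)).elim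
        · linear_combination -h3
        · exact (h2 (by linear_combination huv - h1 - h3)).elim
        · linear_combination -h3
      · rintro rfl
        exact ⟨Or.inr (by linear_combination huv), Or.inr (by ring)⟩
    rw [Set.mem_ofPred_eq, this]
    cases e <;> simp

theorem isTwistedSystem (h : IsTwistedCycle G β N) :
    IsTwistedSystem CycleDist (SameClass β) (OppositeClass β) where
  dist_symm d u v := by
    rintro (h1 | h1)
    · exact Or.inr (by linear_combination -h1)
    · exact Or.inl (by linear_combination -h1)
  dist_neg d u v := by
    rintro (h1 | h1)
    · exact Or.inr (by rw [h1, neg_neg])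
    · exact Or.inl h1
  dist_refl u v huv := Or.inl (by rw [huv, sub_self])
  dist_zero d u w v h1 h2 := by
    have : v.1 = w.1 := by
      rcases h2 with h2 | h2
      · linear_combination h2
      · linear_combination h2
    simpa only [CycleDist, this] using h1
  dist_step d u w v := by
    rintro (h1 | h1) (h2 | h2)
    · exact Or.inl (Or.inl (by linear_combination h1 + h2))
    · exact Or.inr (Or.inl (by linear_combination h1 + h2))
    · exact Or.inr (Or.inr (by linear_combination h1 + h2))
    · exact Or.inl (Or.inr (by linear_combination h1 + h2))
  dist_unique d d' u v := by
    rintro (h1 | h1) (h2 | h2)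
    · exact Or.inl (by rw [← h1, h2])
    · exact Or.inr (by rw [← h1, h2])
    · exact Or.inr (by rw [← h2, h1, neg_neg])
    · exact Or.inl (by rw [← neg_inj, ← h1, h2])
  card_dist_zero u := by
    rw [setOf_cycleDist_zero]
    exact Set.ncard_pair (by simp)
  card_pred d hd u v huv := by
    obtain ⟨t, ht⟩ := h.setOf_cycleDist_pred hd huv
    rw [ht]
    exact Set.ncard_pair (by simp)
  exists_next u v := by
    rintro (h1 | h1)
    · exact ⟨(u.1 + 2, false), Or.inl (by ring), Or.inr (by linear_combination h1)⟩
    · exact ⟨(u.1 - 2, false), Or.inr (by ring), Or.inl (by linear_combination h1)⟩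
  same_symm u v h1 := ⟨h1.1.symm, h1.2.symm⟩
  opp_symm u v h1 := ⟨h1.1.symm, h1.2.symm⟩
  same_refl u v huv := by
    rw [huv]
    exact ⟨rfl, rfl⟩
  not_opp_of_same u v h1 h2 := h2.2 h1.2
  same_same u w v h1 h2 := ⟨h1.1.trans h2.1, h1.2.trans h2.2⟩
  same_opp u w v h1 h2 := ⟨h1.1.trans h2.1, h1.2.symm ▸ h2.2⟩
  opp_opp u w v h1 h2 := by
    refine ⟨h1.1.trans h2.1, ?_⟩
    rw [Bool.eq_not_of_ne h1.2, Bool.eq_not_of_ne h2.2, Bool.not_not]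
  exists_twin u v huv := by
    refine ⟨(u.1, !u.2), Or.inl (sub_self _), ?_⟩
    rw [huv]
    exact ⟨rfl, Bool.not_ne_self _⟩
  color_two u v huv := by
    have : β v.1 = !β u.1 := by
      rcases huv with h1 | h1
      · rw [← h.color_add_two, ← h1, add_sub_cancel]
      · have h2 := h.color_add_two v.1
        rw [show v.1 + 2 = u.1 by linear_combination h1] at h2
        rw [h2, Bool.not_not]
    rintro (h1 | h1) <;> exact Bool.not_ne_self _ (this.symm.trans h1.1.symm)
  color_trans u w v := by
    intro h1 h2
    have hc : ∀ p q : ZMod M × Bool, (SameClass β p q ∨ OppositeClass β p q) ↔ β p.1 = β q.1 := by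
      intro p q
      unfold SameClass OppositeClass
      tauto
    rw [hc] at h1 h2 ⊢
    rw [Bool.eq_not_of_ne h1, Bool.eq_not_of_ne h2, Bool.not_not]

end IsTwistedCycle

namespace PairBisim

variable {V W : Type*} {G : SimpleGraph V} {H : SimpleGraph W} {R : PairBisim G H}

theorem Inv.symm {φ : V → V → Prop} {ψ : W → W → Prop} (h : R.Inv φ ψ)
    (hφ : ∀ u v, φ u v → φ v u) (u v : W) (huv : ψ u v) : ψ v u := by
  have := (R.inv_eq.map₂ (h.forall h fun a b => a → b) fun a b => a → b).transfer (p := id)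
    (by
      rintro u v rfl w
      exact hφ u w)
  exact this u u rfl v huv

theorem isTwistedSystem {M : ℕ} {S : ZMod M → V → V → Prop} {E O : V → V → Prop}
    {S' : ZMod M → W → W → Prop} {E' O' : W → W → Prop} (h : IsTwistedSystem S E O)
    (hS : ∀ d, R.Inv (S d) (S' d)) (hE : R.Inv E E') (hO : R.Inv O O') :
    IsTwistedSystem S' E' O' where
  dist_symm d := (hS d).symm (h.dist_symm d)
  dist_neg d := ((hS d).map₂ (hS (-d)) fun a b => a → b).transfer (p := id) (h.dist_neg d)
  dist_refl := (R.inv_eq.map₂ (hS 0) fun a b => a → b).transfer (p := id) h.dist_refl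
  dist_zero d := (hS d).transfer₃ (hS 0) (hS d) (p := fun a b c => a → b → c) (h.dist_zero d)
  dist_step d := (hS d).transfer₃ (hS 1) ((hS (d + 1)).map₂ (hS (d - 1)) Or)
    (p := fun a b c => a → b → c) (h.dist_step d)
  dist_unique d d' := ((hS d).map₂ (hS d') fun a b => a → b → (d = d' ∨ d = -d')).transfer
    (p := id) (h.dist_unique d d')
  card_dist_zero u := by
    have := ((hS 0).ncard (R.inv_const True) And).transfer (p := fun x => x = 2)
      (fun u _ => by simpa using h.card_dist_zero u) u u
    simpa using this
  card_pred d hd := ((hS d).map₂ ((hS (d - 1)).ncard (hS 1) And) fun a b => a → b = 2).transfer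
    (p := id) (h.card_pred d hd)
  exists_next := ((hS 1).map₂ ((hS 2).exists (hS 1) And) fun a b => a → b).transfer
    (p := id) h.exists_next
  same_symm := hE.symm h.same_symm
  opp_symm := hO.symm h.opp_symm
  same_refl := (R.inv_eq.map₂ hE fun a b => a → b).transfer (p := id) h.same_refl
  not_opp_of_same := (hE.map₂ hO fun a b => a → ¬ b).transfer (p := id) h.not_opp_of_same
  same_same := hE.transfer₃ hE hE (p := fun a b c => a → b → c) h.same_same
  same_opp := hE.transfer₃ hO hO (p := fun a b c => a → b → c) h.same_opp
  opp_opp := hO.transfer₃ hO hE (p := fun a b c => a → b → c) h.opp_opp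
  exists_twin := (R.inv_eq.map₂ ((hS 0).exists hO And) fun a b => a → b).transfer
    (p := id) h.exists_twin
  color_two := ((hS 2).map₂ (hE.map₂ hO Or) fun a b => a → ¬ b).transfer (p := id) h.color_two
  color_trans := (hE.map₂ hO Or).transfer₃ (hE.map₂ hO Or) (hE.map₂ hO Or)
    (p := fun a b c => ¬ a → ¬ b → c) h.color_trans

theorem inv_commonCount [Fintype V] [Fintype W] :
    R.Inv (commonCount G) (commonCount H) := by
  classical
  exact R.inv_adj.sum R.inv_adj fun a b => (if a then (1 : ℤ) else 0) * (if b then 1 else 0)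

end PairBisim

namespace IsTwistedCycle

variable {M : ℕ} [NeZero M] {G : SimpleGraph (ZMod M × Bool)} {β : ZMod M → Bool} {N : ℕ}
  {W : Type*} [Fintype W] {H : SimpleGraph W} (R : PairBisim G H)
include R

theorem exists_inv_sameClass (h : IsTwistedCycle G β N) : ∃ E', R.Inv (SameClass β) E' := by
  refine ⟨fun u v => commonCount H u v ≠ 2, fun u v u' v' hr => ?_⟩
  rw [← R.inv_commonCount.map (fun x => x ≠ 2) hr]
  have h5 := h.five_le
  refine propext ?_
  dsimp only
  rw [h.commonCount_eq]
  by_cases huv : u = v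
  · rw [if_pos huv]
    exact iff_of_true (huv ▸ ⟨rfl, rfl⟩) (by omega)
  · rw [if_neg huv]
    by_cases hc : β u.1 = β v.1 ∧ u.2 = v.2
    · rw [if_pos hc]
      exact iff_of_true hc (by omega)
    · rw [if_neg hc]
      exact iff_of_false hc (by simp)

theorem exists_inv_oppositeClass (h : IsTwistedCycle G β N) :
    ∃ O', R.Inv (OppositeClass β) O' := by
  classical
  obtain ⟨E', hE⟩ := h.exists_inv_sameClass R
  have hsum := R.inv_adj.sum hE fun a b => (if a then (1 : ℤ) else 0) * (if b then 1 else 0)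
  refine ⟨_, fun u v u' v' hr => Eq.trans ?_ ((hsum.map fun x => x ≠ 1) hr)⟩
  have h5 := h.five_le
  refine propext ?_
  have := h.sum_adj_sameClass u v
  dsimp only
  rw [this]
  by_cases hc : β u.1 = β v.1 ∧ u.2 ≠ v.2
  · rw [if_pos hc]
    exact iff_of_true hc (by omega)
  · rw [if_neg hc]
    exact iff_of_false hc (by simp)

theorem exists_inv_cycleDist_one (h : IsTwistedCycle G β N) :
    ∃ F', R.Inv (CycleDist 1) F' := by
  obtain ⟨O', hO⟩ := h.exists_inv_oppositeClass R
  refine ⟨_, fun u v u' v' hr => Eq.trans ?_ ((R.inv_adj.map₂ hO Xor) hr)⟩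
  refine propext ?_
  dsimp only
  rw [h.adj_iff]
  by_cases h1 : CycleDist 1 u v <;> by_cases h2 : OppositeClass β u v <;> simp [Xor, h1, h2]

theorem exists_inv_cycleDist_zero (h : IsTwistedCycle G β N) :
    ∃ T', R.Inv (CycleDist 0) T' := by
  obtain ⟨F', hF⟩ := h.exists_inv_cycleDist_one R
  refine ⟨_, fun u v u' v' hr => Eq.trans ?_ ((hF.forall hF fun a b => a → b) hr)⟩
  refine propext ⟨fun huv w hw => ?_, fun hall => ?_⟩
  · exact h.isTwistedSystem.dist_zero _ _ _ _ (h.isTwistedSystem.dist_symm _ _ _ hw) huv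
  · have h1 := hall (u.1 + 1, false) (Or.inl (by ring))
    have h2 := hall (u.1 - 1, false) (Or.inr (by ring))
    simp only [CycleDist] at h1 h2 ⊢
    rcases h1 with h1 | h1
    · rcases h2 with h2 | h2
      · exact (h.two_ne_zero (by linear_combination h2 - h1)).elim
      · exact (h.four_ne_zero (by linear_combination h2 - h1)).elim
    · exact Or.inl (by linear_combination h1)

/-- All distances along the cycle are definable, by recursion on the distance. -/
theorem exists_inv_cycleDist_nat {k : ℕ} (hM : M = 2 * k) (h : IsTwistedCycle G β N) (i : ℕ)
    (hi : i + 1 ≤ k) :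
    (∃ ψ, R.Inv (CycleDist (i : ZMod M)) ψ) ∧ ∃ ψ, R.Inv (CycleDist ((i + 1 : ℕ) : ZMod M)) ψ := by
  induction i with
  | zero =>
    refine ⟨by simpa using h.exists_inv_cycleDist_zero R,
      by simpa using h.exists_inv_cycleDist_one R⟩
  | succ i ih =>
    obtain ⟨⟨ψ, hψ⟩, ψ', hψ'⟩ := ih (by omega)
    obtain ⟨F', hF⟩ := h.exists_inv_cycleDist_one R
    refine ⟨⟨ψ', hψ'⟩, _, fun u v u' v' hr =>
      Eq.trans ?_ (((hψ'.exists hF And).map₂ hψ fun a b => a ∧ ¬ b) hr)⟩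
    have h2 := h.two_ne_zero
    have hi2 : (2 * (i + 1 : ℕ) : ZMod M) ≠ 0 := by
      intro h0
      have h0' : ((2 * (i + 1) : ℕ) : ZMod M) = 0 := by
        rw [← h0]
        push_cast
        ring
      have := Nat.le_of_dvd (by omega) ((ZMod.natCast_eq_zero_iff _ _).1 h0')
      omega
    refine propext ⟨?_, ?_⟩
    · rintro (h1 | h1)
      · refine ⟨⟨(v.1 - 1, false), Or.inl ?_, Or.inl (by ring)⟩, ?_⟩
        · push_cast at h1 ⊢
          linear_combination h1
        · push_cast at h1 hi2
          rintro (h3 | h3)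
          · exact h2 (by linear_combination h3 - h1)
          · exact hi2 (by linear_combination h3 - h1)
      · refine ⟨⟨(v.1 + 1, false), Or.inr ?_, Or.inr (by ring)⟩, ?_⟩
        · push_cast at h1 ⊢
          linear_combination h1
        · push_cast at h1 hi2
          rintro (h3 | h3)
          · exact hi2 (by linear_combination h1 - h3)
          · exact h2 (by linear_combination h1 - h3)
    · rintro ⟨⟨w, h1, h3⟩, hn⟩
      rcases h.isTwistedSystem.dist_step _ _ _ _ h1 h3 with h4 | h4
      · simpa using h4
      · refine (hn ?_).elim
        simpa using h4

theorem exists_inv_cycleDist {k : ℕ} (hM : M = 2 * k) (h : IsTwistedCycle G β N) (d : ZMod M) :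
    ∃ ψ, R.Inv (CycleDist d) ψ := by
  have hle := ZMod.natAbs_valMinAbs_le d
  have hpos : 0 < M := Nat.pos_of_ne_zero (NeZero.ne M)
  have key : ∃ ψ, R.Inv (CycleDist (d.valMinAbs.natAbs : ZMod M)) ψ := by
    rcases Nat.eq_zero_or_pos d.valMinAbs.natAbs with h0 | h0
    · rw [h0]
      exact (h.exists_inv_cycleDist_nat R hM 0 (by omega)).1
    · obtain ⟨i, hi⟩ := Nat.exists_eq_succ_of_ne_zero h0.ne'
      rw [hi]
      exact (h.exists_inv_cycleDist_nat R hM i (by omega)).2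
  obtain ⟨ψ, hψ⟩ := key
  refine ⟨ψ, fun u v u' v' hr => Eq.trans ?_ (hψ hr)⟩
  have hd : (d.valMinAbs.natAbs : ZMod M) = d ∨ (d.valMinAbs.natAbs : ZMod M) = -d := by
    have h1 := d.coe_valMinAbs
    generalize d.valMinAbs = z at h1
    subst h1
    obtain ⟨i, rfl | rfl⟩ := z.eq_nat_or_neg <;> simp
  rcases hd with hd | hd
  · rw [hd]
  · rw [hd]
    simp only [CycleDist, neg_neg]
    exact propext or_comm

end IsTwistedCycle

namespace IsTwistedSystem

variable {M : ℕ} {W : Type*} {S : ZMod M → W → W → Prop} {E O : W → W → Prop}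

theorem dist_zero_left (h : IsTwistedSystem S E O) {d : ZMod M} {u w v : W} (h1 : S 0 u w)
    (h2 : S d w v) : S d u v :=
  h.dist_symm _ _ _ (h.dist_zero _ _ _ _ (h.dist_symm _ _ _ h2) (h.dist_symm _ _ _ h1))

theorem eq_of_dist_zero (h : IsTwistedSystem S E O) {d : ZMod M} {u v : W} (h1 : S 0 u v)
    (h2 : S d u v) : d = 0 := by
  rcases h.dist_unique _ _ _ _ h2 h1 with h3 | h3
  · exact h3
  · rw [h3, neg_zero]

/-- Away from the two ends of the distance scale, the vertices one step closer to `u` that are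
adjacent to `v` form a single pair of twins. -/
theorem dist_zero_of_pred (h : IsTwistedSystem S E O) {d : ZMod M} (hd : d + d ≠ 0) {u v w w' : W}
    (huv : S d u v) (hw : S (d - 1) u w ∧ S 1 w v) (hw' : S (d - 1) u w' ∧ S 1 w' v) :
    S 0 w w' := by
  have h1 := h.card_pred d hd u v huv
  have h2 : {z | S 0 w z} = {z | S (d - 1) u z ∧ S 1 z v} := by
    refine Set.eq_of_subset_of_ncard_le (fun z hz => ?_) ?_
      (Set.finite_of_ncard_ne_zero (by rw [h1]; exact two_ne_zero))
    · exact ⟨h.dist_zero _ _ _ _ hw.1 hz, h.dist_zero_left (h.dist_symm _ _ _ hz) hw.2⟩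
    · rw [h1, h.card_dist_zero]
  exact (Set.ext_iff.1 h2 w').2 hw'

/-- A walk along the cycle: starting from an edge, always continue to a vertex at distance two from
the last but one. -/
theorem exists_walk (h : IsTwistedSystem S E O) (h2 : (2 : ZMod M) ≠ 0) {a b : W} (hab : S 1 a b) :
    ∃ x : ℕ → W, x 0 = a ∧ x 1 = b ∧ (∀ i, S 2 (x i) (x (i + 2))) ∧
      ∀ j i : ℕ, S (j : ZMod M) (x i) (x (i + j)) := by
  have hnext : ∀ a b, ∃ c, S 1 a b → S 1 b c ∧ S 2 a c := by
    intro a b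
    by_cases hab : S 1 a b
    · obtain ⟨c, h1, h2⟩ := h.exists_next a b hab
      exact ⟨c, fun _ => ⟨h.dist_symm _ _ _ h2, h1⟩⟩
    · exact ⟨a, fun h => (hab h).elim⟩
  choose nx hnx using hnext
  let y : ℕ → W × W := fun i => (fun p => (p.2, nx p.1 p.2))^[i] (a, b)
  have hy : ∀ i, y (i + 1) = ((y i).2, nx (y i).1 (y i).2) := fun i =>
    Function.iterate_succ_apply' _ _ _
  have hy1 : ∀ i, S 1 (y i).1 (y i).2 := by
    intro i
    induction i with
    | zero => exact hab
    | succ i ih =>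
      rw [hy]
      exact (hnx _ _ ih).1
  have hx1 : ∀ i, S 1 (y i).1 (y (i + 1)).1 := by
    intro i
    rw [hy]
    exact hy1 i
  have hx2 : ∀ i, S 2 (y i).1 (y (i + 2)).1 := by
    intro i
    rw [hy (i + 1), hy i]
    exact (hnx _ _ (hy1 i)).2
  have key : ∀ j : ℕ, (∀ i, S (j : ZMod M) (y i).1 (y (i + j)).1) ∧
      ∀ i, S ((j : ZMod M) + 1) (y i).1 (y (i + j + 1)).1 := by
    intro j
    induction j with
    | zero =>
      simp only [Nat.cast_zero, add_zero, zero_add]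
      exact ⟨fun i => h.dist_refl _ _ rfl, hx1⟩
    | succ j ih =>
      rw [Nat.cast_succ]
      refine ⟨ih.2, fun i => ?_⟩
      rcases h.dist_step _ _ _ _ (ih.2 i) (hx1 (i + j + 1)) with h3 | h3
      · exact h3
      by_cases hjj : (j + 1 : ZMod M) + (j + 1) = 0
      · have h4 := h.dist_neg _ _ _ h3
        rwa [show -((j + 1 : ZMod M) - 1) = j + 1 + 1 by linear_combination -hjj] at h4
      · -- a step back towards `x i` would lead to a twin of the previous vertex
        refine (h2 (h.eq_of_dist_zero ?_ (hx2 (i + j)))).elim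
        refine h.dist_zero_of_pred hjj (ih.2 i) ⟨?_, hx1 (i + j)⟩ ⟨h3, h.dist_symm _ _ _ (hx1 _)⟩
        rw [add_sub_cancel_right]
        exact ih.1 i
  exact ⟨fun i => (y i).1, rfl, rfl, hx2, fun j => (key j).1⟩

/-- A set with the relations of a twisted cycle is coordinatised by that cycle. -/
theorem exists_coordinates [NeZero M] [Finite W] (h : IsTwistedSystem S E O)
    (h2 : (2 : ZMod M) ≠ 0) {β : ZMod M → Bool} (hβ : ∀ t, β (t + 2) = !β t)
    (hβ0 : β 0 = false) (hβ1 : β 1 = false) (hcard : Nat.card W = M * 2) {a b : W}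
    (hab : S 1 a b) (hcol : E a b ∨ O a b) :
    ∃ f : ZMod M × Bool ≃ W, ∀ p q,
      (S 1 (f p) (f q) ↔ CycleDist 1 p q) ∧ (O (f p) (f q) ↔ OppositeClass β p q) := by
  obtain ⟨x, hxa, hxb, hx2, hx⟩ := h.exists_walk h2 hab
  have hcsymm : ∀ {u v}, E u v ∨ O u v → E v u ∨ O v u := fun hc =>
    hc.imp (h.same_symm _ _) (h.opp_symm _ _)
  have hctrans : ∀ {u w v}, E u w ∨ O u w → E w v ∨ O w v → E u v ∨ O u v := by
    rintro u w v (h3 | h3) (h4 | h4)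
    · exact Or.inl (h.same_same _ _ _ h3 h4)
    · exact Or.inr (h.same_opp _ _ _ h3 h4)
    · exact Or.inr (h.opp_symm _ _ (h.same_opp _ _ _ (h.same_symm _ _ h4) (h.opp_symm _ _ h3)))
    · exact Or.inl (h.opp_opp _ _ _ h3 h4)
  -- the colour of the vertices of the walk
  have hcolor : ∀ i : ℕ, ((E (x 0) (x i) ∨ O (x 0) (x i)) ↔ β (i : ZMod M) = false) ∧
      ((E (x 0) (x (i + 1)) ∨ O (x 0) (x (i + 1))) ↔ β ((i : ZMod M) + 1) = false) := by
    intro i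
    induction i with
    | zero =>
      simp only [Nat.cast_zero, zero_add, hβ0, hβ1, iff_true, hxa, hxb]
      exact ⟨Or.inl (h.same_refl _ _ rfl), hcol⟩
    | succ i ih =>
      rw [Nat.cast_succ]
      refine ⟨ih.2, ?_⟩
      have hne := h.color_two _ _ (hx2 i)
      rw [show (i : ZMod M) + 1 + 1 = i + 2 by ring, hβ, Bool.not_eq_false', ← Bool.not_eq_false,
        ← ih.1]
      constructor
      · exact fun h3 h4 => hne (hctrans (hcsymm h4) h3)
      · exact fun h3 => h.color_trans _ _ _ h3 hne
  let z : ZMod M → W := fun t => x t.val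
  have hz : ∀ t s, S (s - t) (z t) (z s) := by
    have hle : ∀ t s : ZMod M, t.val ≤ s.val → S (s - t) (z t) (z s) := by
      intro t s hts
      obtain ⟨j, hj⟩ := Nat.exists_eq_add_of_le hts
      have h3 := hx j t.val
      rw [← hj] at h3
      have h4 : (j : ZMod M) = s - t := by
        rw [← ZMod.natCast_zmod_val s, hj, Nat.cast_add, ZMod.natCast_zmod_val,
          add_sub_cancel_left]
      rwa [h4] at h3
    intro t s
    rcases le_total t.val s.val with hts | hts
    · exact hle t s hts
    · have := h.dist_neg _ _ _ (h.dist_symm _ _ _ (hle s t hts))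
      rwa [neg_sub] at this
  have hzc : ∀ t, (E (x 0) (z t) ∨ O (x 0) (z t)) ↔ β t = false := by
    intro t
    have := (hcolor t.val).1
    rwa [ZMod.natCast_zmod_val] at this
  -- reference vertices of the two colours
  let r : Bool → W := fun c => if c then x 2 else x 0
  have hx02 : ¬ (E (x 0) (x 2) ∨ O (x 0) (x 2)) := h.color_two _ _ (hx2 0)
  have hrz : ∀ t, E (r (β t)) (z t) ∨ O (r (β t)) (z t) := by
    intro t
    have h3 := hzc t
    rcases hb : β t with _ | _
    · exact h3.2 hb
    · rw [hb] at h3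
      simp only [Bool.true_eq_false, iff_false] at h3
      exact h.color_trans _ _ _ (fun h4 => hx02 (hcsymm h4)) h3
  have hrr : ∀ c c', (E (r c) (r c') ∨ O (r c) (r c')) → c = c' := by
    rintro (_ | _) (_ | _) h3
    · rfl
    · exact (hx02 h3).elim
    · exact (hx02 (hcsymm h3)).elim
    · rfl
  have htwin : ∀ t, ∃ w, S 0 (z t) w ∧ O (z t) w := by
    intro t
    obtain ⟨w, h3, h4⟩ := h.exists_twin (z t) (z t) rfl
    exact ⟨w, h3, h.opp_symm _ _ h4⟩
  have hexists : ∀ p : ZMod M × Bool, ∃ w, S 0 (z p.1) w ∧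
      (p.2 = false → E (r (β p.1)) w) ∧ (p.2 = true → O (r (β p.1)) w) := by
    rintro ⟨t, e⟩
    obtain ⟨w, hw, hw'⟩ := htwin t
    have hself : S 0 (z t) (z t) := h.dist_refl _ _ rfl
    rcases hrz t with h3 | h3 <;> rcases e with _ | _
    · exact ⟨z t, hself, fun _ => h3, fun h => (by cases h)⟩
    · exact ⟨w, hw, fun h => (by cases h), fun _ => h.same_opp _ _ _ h3 hw'⟩
    · exact ⟨w, hw, fun _ => h.opp_opp _ _ _ h3 hw', fun h => (by cases h)⟩
    · exact ⟨z t, hself, fun h => (by cases h), fun _ => h3⟩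
  choose f hf0 hfE hfO using hexists
  have hfS : ∀ p q, S (q.1 - p.1) (f p) (f q) := fun p q =>
    h.dist_zero _ _ _ _ (h.dist_zero_left (h.dist_symm _ _ _ (hf0 p)) (hz p.1 q.1)) (hf0 q)
  have hS : ∀ p q, S 1 (f p) (f q) ↔ CycleDist 1 p q := by
    intro p q
    constructor
    · exact fun h3 => h.dist_unique _ _ _ _ (hfS p q) h3
    · rintro (h3 | h3)
      · exact h3 ▸ hfS p q
      · have := h.dist_neg _ _ _ (hfS p q)
        rwa [h3, neg_neg] at this
  have hfr : ∀ p, E (r (β p.1)) (f p) ∨ O (r (β p.1)) (f p) := by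
    intro p
    rcases he : p.2 with _ | _
    · exact Or.inl (hfE p he)
    · exact Or.inr (hfO p he)
  have hsame : ∀ p q, β p.1 = β q.1 → p.2 = q.2 → E (f p) (f q) := by
    intro p q hb he
    rcases hp : p.2 with _ | _
    · have h3 := hfE p hp
      have h4 := hfE q (he ▸ hp)
      rw [hb] at h3
      exact h.same_same _ _ _ (h.same_symm _ _ h3) h4
    · have h3 := hfO p hp
      have h4 := hfO q (he ▸ hp)
      rw [hb] at h3
      exact h.opp_opp _ _ _ (h.opp_symm _ _ h3) h4
  have hopp : ∀ p q, p.2 = false → q.2 = true → β p.1 = β q.1 → O (f p) (f q) := by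
    intro p q hp hq hb
    have h3 := hfE p hp
    have h4 := hfO q hq
    rw [hb] at h3
    exact h.same_opp _ _ _ (h.same_symm _ _ h3) h4
  have hO : ∀ p q, O (f p) (f q) ↔ OppositeClass β p q := by
    intro p q
    constructor
    · intro h3
      have hb : β p.1 = β q.1 := hrr _ _ (hctrans (hctrans (hfr p) (Or.inr h3)) (hcsymm (hfr q)))
      exact ⟨hb, fun he => h.not_opp_of_same _ _ (hsame p q hb he) h3⟩
    · rintro ⟨hb, he⟩
      rcases hp : p.2 with _ | _
      · exact hopp p q hp (by rw [Bool.eq_not_of_ne he.symm, hp, Bool.not_false]) hb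
      · exact h.opp_symm _ _
          (hopp q p (by rw [Bool.eq_not_of_ne he.symm, hp, Bool.not_true]) hp hb.symm)
  have hinj : Function.Injective f := by
    intro p q hpq
    have h3 : q.1 - p.1 = 0 := h.eq_of_dist_zero (h.dist_refl _ _ hpq) (hfS p q)
    have h4 : p.1 = q.1 := (sub_eq_zero.1 h3).symm
    refine Prod.ext h4 ?_
    by_contra he
    exact h.not_opp_of_same _ _ (h.same_refl _ _ hpq) ((hO p q).2 ⟨by rw [h4], he⟩)
  refine ⟨Equiv.ofBijective f (hinj.bijective_of_nat_card_le ?_), fun p q => ⟨hS p q, hO p q⟩⟩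
  rw [hcard]
  simp

end IsTwistedSystem

namespace IsTwistedCycle

variable {M : ℕ} [NeZero M] {G : SimpleGraph (ZMod M × Bool)} {β : ZMod M → Bool} {N : ℕ}

theorem nonempty_iso {k : ℕ} (hM : M = 2 * k) (h : IsTwistedCycle G β N) {W : Type*} [Fintype W]
    {H : SimpleGraph W} (R : PairBisim G H) : Nonempty (G ≃g H) := by
  obtain ⟨E', hE⟩ := h.exists_inv_sameClass R
  obtain ⟨O', hO⟩ := h.exists_inv_oppositeClass R
  choose S' hS using h.exists_inv_cycleDist R hM
  have hsys := R.isTwistedSystem h.isTwistedSystem hS hE hO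
  obtain ⟨a, b, hr⟩ := R.left_total (0, false) (1, false)
  obtain ⟨e⟩ := R.nonempty_equiv
  obtain ⟨f, hf⟩ := hsys.exists_coordinates h.two_ne_zero h.color_add_two h.color_zero h.color_one
    (by rw [← Nat.card_congr e]; simp) (a := a) (b := b)
    (by rw [← hS 1 hr]; exact Or.inl (sub_zero 1))
    (by
      rw [← hE hr, ← hO hr]
      exact Or.inl ⟨by rw [h.color_zero, h.color_one], rfl⟩)
  have hadj : ∀ u v, H.Adj u v ↔ Xor (S' 1 u v) (O' u v) := by
    refine (R.inv_adj.map₂ ((hS 1).map₂ hO Xor) Iff).transfer (p := id) fun u v => ?_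
    exact h.adj_iff u v
  refine ⟨⟨f, fun {p q} => ?_⟩⟩
  rw [hadj, h.adj_iff, (hf p q).1, (hf p q).2]

/-- A regular graph with the order and degree of a twisted cycle, in which two vertices of the same
class have at least `N` common neighbours, namely the vertices of the opposite class. -/
def comparisonGraph (h : IsTwistedCycle G β N) : SimpleGraph (ZMod M × Bool) where
  Adj p q := OppositeClass β p q ∨ (CycleDist 2 p q ∧ p.2 = q.2)
  symm := ⟨fun p q => Or.imp (h.isTwistedSystem.opp_symm p q) fun h1 =>
    ⟨h.isTwistedSystem.dist_symm _ p q h1.1, h1.2.symm⟩⟩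
  loopless := ⟨by
    rintro p (h1 | h1)
    · exact h1.2 rfl
    · exact h.two_ne_zero
        (h.isTwistedSystem.eq_of_dist_zero (h.isTwistedSystem.dist_refl p p rfl) h1.1)⟩

theorem ncard_oppositeClass (h : IsTwistedCycle G β N) (p : ZMod M × Bool) :
    {w | OppositeClass β p w}.ncard = N := by
  rw [← h.card_color (β p.1), ← Set.ncard_coe_finset]
  refine (congrArg Set.ncard (Set.ext fun w => ?_)).trans
    (Set.ncard_image_of_injective _ (Prod.mk_left_injective (!p.2)))
  simp only [OppositeClass, Set.mem_ofPred_eq, Finset.coe_filter, Finset.mem_univ, true_and,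
    Set.mem_image]
  constructor
  · rintro ⟨h1, h2⟩
    exact ⟨w.1, h1.symm, Prod.ext rfl (by rw [Bool.eq_not_of_ne h2, Bool.not_not])⟩
  · rintro ⟨t, h1, rfl⟩
    exact ⟨h1.symm, (Bool.not_ne_self _).symm⟩

theorem ncard_comparisonGraph_adj (h : IsTwistedCycle G β N) (p : ZMod M × Bool) :
    {w | h.comparisonGraph.Adj p w}.ncard = N + 2 := by
  have h1 : {w | CycleDist 2 p w ∧ p.2 = w.2} = {(p.1 + 2, p.2), (p.1 - 2, p.2)} := by
    ext ⟨t, e⟩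
    simp only [CycleDist, Set.mem_ofPred_eq, Set.mem_insert_iff, Set.mem_singleton_iff,
      Prod.mk.injEq, sub_eq_iff_eq_add', ← sub_eq_add_neg, eq_comm (a := p.2)]
    tauto
  have h2 : {w | h.comparisonGraph.Adj p w} =
      {w | OppositeClass β p w} ∪ {w | CycleDist 2 p w ∧ p.2 = w.2} := rfl
  rw [h2, Set.ncard_union_eq _ (Set.toFinite _) (Set.toFinite _), h.ncard_oppositeClass, h1,
    Set.ncard_pair]
  · intro h3
    exact h.four_ne_zero (by linear_combination congrArg Prod.fst h3)
  · exact Set.disjoint_left.2 fun w h3 h4 => h3.2 h4.2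

theorem not_nonempty_iso_comparisonGraph (h : IsTwistedCycle G β N) :
    ¬ Nonempty (G ≃g h.comparisonGraph) := by
  rintro ⟨e⟩
  have h5 := h.five_le
  have hG : ∀ u v, u ≠ v → commonCount G u v < N := by
    intro u v huv
    rw [h.commonCount_eq, if_neg huv]
    split_ifs <;> omega
  have hH := ((PairBisim.ofIso e).inv_eq.map₂ (PairBisim.ofIso e).inv_commonCount
    fun a b => ¬ a → b < N).transfer (p := id) hG
  have h1 : ((0 : ZMod M), false) ≠ (1, false) := by
    intro h3
    exact h.two_ne_zero (by linear_combination -2 * congrArg Prod.fst h3)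
  have h2 := hH _ _ h1
  rw [commonCount_eq_ncard] at h2
  have h3 : {w | OppositeClass β ((0 : ZMod M), false) w} ⊆
      {w | h.comparisonGraph.Adj (0, false) w ∧ h.comparisonGraph.Adj w (1, false)} := by
    intro w hw
    refine ⟨Or.inl hw, Or.inl ⟨?_, hw.2.symm⟩⟩
    rw [← hw.1, h.color_zero, h.color_one]
  have h4 := Set.ncard_le_ncard h3 (Set.toFinite _)
  rw [h.ncard_oppositeClass] at h4
  omega

theorem wlDim_eq_two_of_iso {k : ℕ} (hM : M = 2 * k) (h : IsTwistedCycle G β N) {U : Type}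
    [Fintype U] {Γ : SimpleGraph U} (e : Γ ≃g G) : wlDim Γ = 2 := by
  refine wlDim_eq_two (H := h.comparisonGraph) (d := N + 2) (Fintype.card_congr e.toEquiv)
    (fun v => ?_) h.ncard_comparisonGraph_adj ?_ ?_
  · rw [← h.ncard_adj (e v), ← Set.ncard_image_of_injective _ e.injective]
    refine congrArg Set.ncard (Set.ext fun w => ?_)
    constructor
    · rintro ⟨w, hw, rfl⟩
      exact e.map_adj_iff.2 hw
    · intro hw
      refine ⟨e.symm w, e.map_adj_iff.1 ?_, e.apply_symm_apply w⟩
      rw [e.apply_symm_apply]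
      exact hw
  · rintro ⟨e'⟩
    exact h.not_nonempty_iso_comparisonGraph ⟨e.symm.trans e'⟩
  · intro W _ H R
    obtain ⟨e'⟩ := h.nonempty_iso hM (R.compIso e.symm)
    exact ⟨e.trans e'⟩

end IsTwistedCycle

/-! ### The graphs `Σ(k)` as twisted cycles -/

section Sigma

variable {k : ℕ}

/-- The reduction of the rotation index modulo four. -/
def modFour (k : ℕ) : ZMod (4 * k) →+* ZMod 4 := ZMod.castHom (Dvd.intro k rfl) (ZMod 4)

/-- The colour of the position `t` on the cycle of length `4 k`. -/
def sigmaColor (k : ℕ) (t : ZMod (4 * k)) : Bool := decide (modFour k t = 2 ∨ modFour k t = 3)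

/-- The coordinates in which `Σ(k)` is a twisted cycle: the position on the cycle of length `4 k`,
and the index that tells opposite classes apart. Since `4 k` is even, the rotations have the even and
the reflections the odd positions; the two elements at a position differ by the central rotation
`r (2 k)`, and have different indices because `k` is odd. The shift by `3` places the elements
`y x⁻¹`, `y x^(2k-1)` and `y x⁻²`, `y x^(2k-2)` of the dihedral group on both sides of the identity. -/
def sigmaCoord (k : ℕ) : DihedralGroup (4 * k) → ZMod (4 * k) × Bool
  | .r a => (-2 * a, decide (modFour k a = 2 ∨ modFour k a = 3))
  | .sr b => (-2 * b - 3, decide (modFour k b = 0 ∨ modFour k b = 1))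

theorem mem_zpowers_dihX_iff [NeZero k] (g : DihedralGroup (4 * k)) :
    g ∈ Subgroup.zpowers (dihX k ^ 4) ↔ ∃ c, modFour k c = 0 ∧ g = .r c := by
  simp only [Subgroup.mem_zpowers_iff, dihX, DihedralGroup.r_one_pow, DihedralGroup.r_zpow]
  constructor
  · rintro ⟨z, rfl⟩
    refine ⟨_, ?_, rfl⟩
    rw [map_mul, map_natCast]
    exact mul_eq_zero_of_left (by decide) _
  · rintro ⟨c, hc, rfl⟩
    rw [← ZMod.natCast_zmod_val c, map_natCast, ZMod.natCast_eq_zero_iff] at hc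
    obtain ⟨d, hd⟩ := hc
    refine ⟨d, ?_⟩
    rw [← ZMod.natCast_zmod_val c, hd]
    push_cast
    rfl

theorem r_mem_sigmaSet [NeZero k] (c : ZMod (4 * k)) :
    DihedralGroup.r c ∈ sigmaSet k ↔ modFour k c = 2 := by
  simp only [sigmaSet, Set.mem_union, Set.mem_ofPred_eq, mem_zpowers_dihX_iff]
  simp only [Set.mem_insert_iff, Set.mem_singleton_iff, dihX, dihY, DihedralGroup.r_one_pow,
    DihedralGroup.r_zpow, DihedralGroup.sr_mul_r, reduceCtorEq, or_false]
  constructor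
  · rintro (⟨_, ⟨d, hd, rfl⟩, h⟩ | ⟨_, ⟨d, hd, rfl⟩, -, h⟩)
    · rw [DihedralGroup.r_mul_r] at h
      rw [DihedralGroup.r.inj h, map_add, hd, map_natCast]
      decide
    · cases h
  · intro h
    refine Or.inl ⟨_, ⟨c - 2, ?_, rfl⟩, ?_⟩
    · rw [map_sub, h, map_ofNat, sub_self]
    · rw [DihedralGroup.r_mul_r]
      congr 1
      push_cast
      ring

theorem sr_mem_sigmaSet [NeZero k] (c : ZMod (4 * k)) :
    DihedralGroup.sr c ∈ sigmaSet k ↔ (modFour k c = 0 ∧ c ≠ 2 * k - 2) ∨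
      c = 2 * k - 1 ∨ c = -2 ∨ c = -1 := by
  have h1 : ((2 * ((k : ℤ) - 1) : ℤ) : ZMod (4 * k)) = 2 * k - 2 := by
    push_cast
    ring
  have h2 : ((2 * (k : ℤ) - 1 : ℤ) : ZMod (4 * k)) = 2 * k - 1 := by
    push_cast
    ring
  have h3 : ((-2 : ℤ) : ZMod (4 * k)) = -2 := by push_cast; rfl
  have h4 : ((-1 : ℤ) : ZMod (4 * k)) = -1 := by push_cast; rfl
  simp only [sigmaSet, Set.mem_union, Set.mem_ofPred_eq, mem_zpowers_dihX_iff]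
  simp only [Set.mem_insert_iff, Set.mem_singleton_iff, dihX, dihY, DihedralGroup.r_one_pow,
    DihedralGroup.r_zpow, DihedralGroup.sr_mul_r, one_mul, h1, h2, h3, h4, zero_add,
    DihedralGroup.sr.injEq]
  refine or_congr ?_ Iff.rfl
  constructor
  · rintro (⟨_, ⟨d, hd, rfl⟩, h⟩ | ⟨_, ⟨d, hd, rfl⟩, hne, h⟩)
    · cases h
    · rw [DihedralGroup.sr_mul_r, zero_add] at h
      rw [DihedralGroup.sr.inj h]
      exact ⟨hd, fun h => hne (by rw [h])⟩
  · rintro ⟨h, hne⟩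
    exact Or.inr ⟨_, ⟨c, h, rfl⟩, fun h => hne (DihedralGroup.r.inj h),
      by rw [DihedralGroup.sr_mul_r, zero_add]⟩

theorem two_mul_eq_zero_iff [NeZero k] (c : ZMod (4 * k)) :
    2 * c = 0 ↔ c = 0 ∨ c = 2 * k := by
  constructor
  · intro h
    have hv := ZMod.val_lt c
    have h1 : ((2 * c.val : ℕ) : ZMod (4 * k)) = 0 := by
      rw [Nat.cast_mul, ZMod.natCast_zmod_val]
      exact_mod_cast h
    rw [ZMod.natCast_eq_zero_iff] at h1
    obtain ⟨d, hd⟩ := h1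
    have hd2 : d < 2 := by
      by_contra! hd2
      have := Nat.mul_le_mul_left (4 * k) hd2
      omega
    interval_cases d
    · left
      rw [← ZMod.natCast_zmod_val c, show c.val = 0 by omega, Nat.cast_zero]
    · right
      rw [← ZMod.natCast_zmod_val c, show c.val = 2 * k by omega]
      push_cast
      rfl
  · rintro (rfl | rfl)
    · rw [mul_zero]
    · have := ZMod.natCast_self (4 * k)
      push_cast at this
      linear_combination this

theorem modFour_two_mul (hk : Odd k) : modFour k (2 * k) = 2 := by
  obtain ⟨d, rfl⟩ := hk
  have : ∀ x : ZMod 4, 2 * (2 * x + 1) = 2 := by decide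
  rw [map_mul, map_ofNat, map_natCast]
  push_cast
  exact this _

theorem not_cycleDist_one_of_modFour {p q : ZMod (4 * k) × Bool}
    (h : modFour k q.1 - modFour k p.1 ≠ 1 ∧ modFour k q.1 - modFour k p.1 ≠ -1) :
    ¬ CycleDist 1 p q := by
  rintro (h1 | h1)
  · exact h.1 (by rw [← map_sub, h1, map_one])
  · exact h.2 (by rw [← map_sub, h1, map_neg, map_one])

/-- Removing the part `A₂` from `P` and adding `A₁`, `A₃` and `A₄` is a symmetric difference. -/
theorem switch_iff_xor {P A₁ A₂ A₃ A₄ : Prop} (h₁ : A₁ → ¬ P) (h₂ : A₂ → P) (h₃ : A₃ → ¬ P)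
    (h₄ : A₄ → ¬ P) :
    ((P ∧ ¬ A₂) ∨ A₄ ∨ A₁ ∨ A₃) ↔ Xor ((A₁ ∨ A₂) ∨ (A₃ ∨ A₄)) P := by
  by_cases P <;> simp_all [Xor]
  tauto

/-- The neighbours of the identity among the reflections form the symmetric difference of two sets:
the coset `y A₁`, which consists of the reflections in the class opposite to that of the identity,
and the four reflections `y x⁻²`, `y x^(2k-2)`, `y x⁻¹`, `y x^(2k-1)` at the neighbouring positions.
The rotations adjacent to the identity are the other elements of the opposite class. -/
theorem sigmaGraph_adj_iff [NeZero k] (hk : Odd k) (g h : DihedralGroup (4 * k)) :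
    (sigmaGraph k).Adj g h ↔ Xor (CycleDist 1 (sigmaCoord k g) (sigmaCoord k h))
      (OppositeClass (sigmaColor k) (sigmaCoord k g) (sigmaCoord k h)) := by
  have hrs : ∀ a b, (sigmaGraph k).Adj (.r a) (.sr b) ↔
      Xor (CycleDist 1 (sigmaCoord k (.r a)) (sigmaCoord k (.sr b)))
        (OppositeClass (sigmaColor k) (sigmaCoord k (.r a)) (sigmaCoord k (.sr b))) := by
    intro a b
    have h1 : (sigmaGraph k).Adj (.r a) (.sr b) ↔ DihedralGroup.sr (b - a) ∈ sigmaSet k := by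
      simp [sigmaGraph, cayleyGraph, sub_eq_add_neg]
    have h2 : CycleDist 1 (sigmaCoord k (.r a)) (sigmaCoord k (.sr b)) ↔
        (b - a = -2 ∨ b - a = 2 * k - 2) ∨ (b - a = -1 ∨ b - a = 2 * k - 1) := by
      simp only [CycleDist, sigmaCoord]
      refine or_congr ?_ ?_
      · have := two_mul_eq_zero_iff (b - a + 2)
        rw [or_congr (eq_neg_iff_add_eq_zero (a := b - a)) (eq_sub_iff_add_eq (a := b - a)),
          ← this]
        exact ⟨fun h => by linear_combination -h, fun h => by linear_combination -h⟩
      · have := two_mul_eq_zero_iff (b - a + 1)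
        rw [or_congr (eq_neg_iff_add_eq_zero (a := b - a)) (eq_sub_iff_add_eq (a := b - a)),
          ← this]
        exact ⟨fun h => by linear_combination -h, fun h => by linear_combination -h⟩
    have h3 : OppositeClass (sigmaColor k) (sigmaCoord k (.r a)) (sigmaCoord k (.sr b)) ↔
        modFour k (b - a) = 0 := by
      simp only [OppositeClass, sigmaCoord, sigmaColor, map_sub, map_mul, map_neg, map_ofNat]
      generalize modFour k a = x
      generalize modFour k b = y
      revert x y
      decide
    have e1 : b - a = -2 → modFour k (b - a) ≠ 0 := by
      intro e
      rw [e, map_neg, map_ofNat]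
      decide
    have e2 : b - a = 2 * k - 2 → modFour k (b - a) = 0 := by
      intro e
      rw [e, map_sub, modFour_two_mul hk, map_ofNat]
      decide
    have e3 : b - a = -1 → modFour k (b - a) ≠ 0 := by
      intro e
      rw [e, map_neg, map_one]
      decide
    have e4 : b - a = 2 * k - 1 → modFour k (b - a) ≠ 0 := by
      intro e
      rw [e, map_sub, modFour_two_mul hk, map_one]
      decide
    rw [h1, h2, h3, sr_mem_sigmaSet]
    exact switch_iff_xor e1 e2 e3 e4
  rcases g with a | a <;> rcases h with b | b
  · have h1 : (sigmaGraph k).Adj (.r a) (.r b) ↔ DihedralGroup.r (b - a) ∈ sigmaSet k := by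
      simp [sigmaGraph, cayleyGraph, sub_eq_add_neg]
    have h2 : ¬ CycleDist 1 (sigmaCoord k (.r a)) (sigmaCoord k (.r b)) := by
      refine not_cycleDist_one_of_modFour ?_
      simp only [sigmaCoord, map_mul, map_neg, map_ofNat]
      generalize modFour k a = x
      generalize modFour k b = y
      revert x y
      decide
    rw [h1, r_mem_sigmaSet]
    simp only [Xor, h2, false_and, not_false_eq_true, and_true, false_or]
    simp only [OppositeClass, sigmaCoord, sigmaColor, map_sub, map_mul, map_neg, map_ofNat]
    generalize modFour k a = x
    generalize modFour k b = y
    revert x y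
    decide
  · exact hrs a b
  · rw [SimpleGraph.adj_comm, hrs]
    have h1 : CycleDist 1 (sigmaCoord k (.r b)) (sigmaCoord k (.sr a)) ↔
        CycleDist 1 (sigmaCoord k (.sr a)) (sigmaCoord k (.r b)) := by
      simp only [CycleDist]
      rw [or_comm]
      exact or_congr ⟨fun h => by linear_combination -h, fun h => by linear_combination -h⟩
        ⟨fun h => by linear_combination -h, fun h => by linear_combination -h⟩
    have h2 : OppositeClass (sigmaColor k) (sigmaCoord k (.r b)) (sigmaCoord k (.sr a)) ↔
        OppositeClass (sigmaColor k) (sigmaCoord k (.sr a)) (sigmaCoord k (.r b)) :=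
      and_congr eq_comm ne_comm
    rw [h1, h2]
  · have h1 : (sigmaGraph k).Adj (.sr a) (.sr b) ↔ DihedralGroup.r (a - b) ∈ sigmaSet k := by
      simp [sigmaGraph, cayleyGraph]
    have h2 : ¬ CycleDist 1 (sigmaCoord k (.sr a)) (sigmaCoord k (.sr b)) := by
      refine not_cycleDist_one_of_modFour ?_
      simp only [sigmaCoord, map_mul, map_neg, map_ofNat, map_sub]
      generalize modFour k a = x
      generalize modFour k b = y
      revert x y
      decide
    rw [h1, r_mem_sigmaSet]
    simp only [Xor, h2, false_and, not_false_eq_true, and_true, false_or]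
    simp only [OppositeClass, sigmaCoord, sigmaColor, map_sub, map_mul, map_neg, map_ofNat]
    generalize modFour k a = x
    generalize modFour k b = y
    revert x y
    decide

theorem sigmaCoord_injective [NeZero k] (hk : Odd k) : Function.Injective (sigmaCoord k) := by
  have hpar : ∀ a b : ZMod (4 * k), -2 * a ≠ -2 * b - 3 := by
    intro a b h
    have h1 := congrArg (modFour k) h
    simp only [map_mul, map_neg, map_ofNat, map_sub] at h1
    generalize modFour k a = x at h1
    generalize modFour k b = y at h1
    revert x y
    decide
  have hsame : ∀ a b : ZMod (4 * k), 2 * (a - b) = 0 → a ≠ b →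
      modFour k a = modFour k b + 2 := by
    intro a b h hab
    rcases (two_mul_eq_zero_iff _).1 h with h1 | h1
    · exact (hab (sub_eq_zero.1 h1)).elim
    · rw [sub_eq_iff_eq_add'.1 h1, map_add, modFour_two_mul hk]
  rintro (a | a) (b | b) h
  · by_contra hne
    have h0 := congrArg Prod.fst h
    simp only [sigmaCoord] at h0
    have h1 := hsame a b (by linear_combination -h0) fun e => hne (by rw [e])
    have h2 := congrArg Prod.snd h
    simp only [sigmaCoord, h1] at h2
    generalize modFour k b = y at h2
    revert y
    decide
  · exact (hpar a b (congrArg Prod.fst h)).elim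
  · exact (hpar b a (congrArg Prod.fst h).symm).elim
  · by_contra hne
    have h0 := congrArg Prod.fst h
    simp only [sigmaCoord] at h0
    have h1 := hsame a b (by linear_combination -h0) fun e => hne (by rw [e])
    have h2 := congrArg Prod.snd h
    simp only [sigmaCoord, h1] at h2
    generalize modFour k b = y at h2
    revert y
    decide

theorem sigmaColor_add_two (t : ZMod (4 * k)) : sigmaColor k (t + 2) = !sigmaColor k t := by
  simp only [sigmaColor, map_add, map_ofNat]
  generalize modFour k t = x
  revert x
  decide

theorem card_sigmaColor [NeZero k] (b : Bool) :
    (Finset.univ.filter fun t => sigmaColor k t = b).card = 2 * k := by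
  have h1 : ∀ b, (Finset.univ.filter fun t => sigmaColor k t = b).card ≤
      (Finset.univ.filter fun t => sigmaColor k t = !b).card := by
    intro b
    refine Finset.card_le_card_of_injOn (fun t => t + 2) ?_ (add_left_injective _).injOn
    intro t ht
    have ht' : sigmaColor k t = b := by simpa using ht
    simp [sigmaColor_add_two, ht']
  have h2 := Finset.card_filter_add_card_filter_not (s := (Finset.univ : Finset (ZMod (4 * k))))
    (fun t => sigmaColor k t = true)
  rw [Finset.card_univ, ZMod.card] at h2
  simp only [Bool.not_eq_true] at h2
  have h3 := h1 true
  have h4 := h1 false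
  rw [Bool.not_true] at h3
  rw [Bool.not_false] at h4
  cases b <;> omega

theorem wlDim_sigmaGraph [NeZero k] (hk3 : 3 ≤ k) (hk : Odd k) : wlDim (sigmaGraph k) = 2 := by
  have hcard : Nat.card (ZMod (4 * k) × Bool) ≤ Nat.card (DihedralGroup (4 * k)) := by
    rw [DihedralGroup.nat_card]
    simp [mul_comm]
  let f := Equiv.ofBijective (sigmaCoord k)
    ((sigmaCoord_injective hk).bijective_of_nat_card_le hcard)
  have hne : ∀ n : ℕ, 0 < n → n < 4 * k → (n : ZMod (4 * k)) ≠ 0 := by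
    intro n hn hlt h
    exact absurd (Nat.le_of_dvd hn ((ZMod.natCast_eq_zero_iff _ _).1 h)) (by omega)
  have hG : IsTwistedCycle ((sigmaGraph k).comap f.symm) (sigmaColor k) (2 * k) := by
    refine ⟨fun p q => ?_, sigmaColor_add_two, ?_, ?_, ?_, ?_, card_sigmaColor, by omega⟩
    · obtain ⟨g, rfl⟩ := f.surjective p
      obtain ⟨h, rfl⟩ := f.surjective q
      rw [SimpleGraph.comap_adj, f.symm_apply_apply, f.symm_apply_apply]
      exact sigmaGraph_adj_iff hk g h
    · rw [sigmaColor, map_zero]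
      decide
    · rw [sigmaColor, map_one]
      decide
    · exact_mod_cast hne 2 (by omega) (by omega)
    · exact_mod_cast hne 4 (by omega) (by omega)
  exact hG.wlDim_eq_two_of_iso (k := 2 * k) (by ring)
    (SimpleGraph.Iso.comap f.symm (sigmaGraph k)).symm

end Sigma

theorem theorem4 :
    (∀ (m : ℕ), 1 ≤ m → ∀ (n : ℕ) [NeZero n], n ≤ 13 →
      ∀ (D : Finset (ZMod n)), IsDifferenceSet D → D.card + 1 < n → ∀ (j : ZMod n),
        wlDim (lexProductGraph (SimpleGraph.completeGraph (Fin m)) (gammaGraph n D j)) = 2) ∧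
    (∀ (m : ℕ), 1 ≤ m →
      wlDim (lexProductGraph (SimpleGraph.completeGraph (Fin m))
        (SimpleGraph.boxProd (SimpleGraph.completeGraph (Fin 4))
          (SimpleGraph.completeGraph (Fin 2)))) = 2) ∧
    (∀ (k : ℕ) [NeZero k], 3 ≤ k → Odd k → wlDim (sigmaGraph k) = 2) :=
  ⟨fun _ hm _ _ hn _ hD hDn j => wlDim_lexProduct_gammaGraph_of_le_thirteen hn hD hDn j hm,
    fun _ hm => wlDim_lexProduct_boxProd hm, fun _ _ hk3 hk => wlDim_sigmaGraph hk3 hk⟩
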